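/- **Setting.** Write $\mathbb D(0,\rho)=\{z\in\mathbb C:|z|<\rho\}$ and let $q\ge 1$. Let $g(z)=\lambda z+O(z^2)$ be holomorphic near $0$, where $\lambda$ is a primitive $q$th root of unity, and suppose that the parabolic fixed point $0$ is non-degenerate, i.e. $f:=g^{\circ q}$ satisfies $f(z)-z=az^{q+1}+O(z^{q+2})$ with $a\neq 0$. Let $r_0>0$ be such that $f$ is defined and holomorphic in a neighborhood of $\overline{\mathbb D}(0,r_0)$, is univalent there, satisfies $\operatorname{Re} f'>0$ on $\overline{\mathbb D}(0,r_0)$, and has $0$ as its only fixed point in $\overline{\mathbb D}(0,r_0)$. Consider a sequence $g_n(z)=\lambda_n z+O(z^2)$ with $|\lambda_n|\neq 1$ such that $f_n:=g_n^{\circ q}$ is defined and holomorphic in a neighborhood of $\overline{\mathbb D}(0,r_0)$, and $g_n\to g$, $f_n\to f$ uniformly on $\overline{\mathbb D}(0,r_0)$. Let $\mathscr O_n$ be the set of nonzero points of $\overline{\mathbb D}(0,r_0)$ of exact period $q$ under $g_n$; for large $n$ it is a single $q$-cycle, which bifurcates from $0$, and $\{0\}\cup\mathscr O_n$ is the set of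 all fixed points of $f_n$ in $\overline{\mathbb D}(0,r_0)$. Let $\gamma:\,]-\infty,0]\to\mathbb D(0,r_0)$ and $\gamma_n:\,]-\infty,0]\to\mathbb C$ be continuous injective curves such that $f(\gamma(t))=\gamma(t+1)$ for all $t\le -1$; $f_n(\gamma_n(t))=\gamma_n(t+1)$ for all $t\le -1$ with $\gamma_n(t)\in\overline{\mathbb D}(0,r_0)$; $\lim_{t\to-\infty}\gamma(t)=0$; and $\gamma_n\to\gamma$ uniformly on compact subsets of $]-\infty,0]$. **Theorem (Near miss arcs pass through the gates).** There is an $R\in\,]0,r_0]$, depending only on $g$, $q$ and $r_0$, such that the following holds for every $0<r<R$ and all $g_n,\gamma,\gamma_n$ as above. Suppose that there are sequences $-\infty<s_n<t_n\le 0$ such that, for $t\le 0$, $\gamma_n(t)\in\mathbb D(0,r)$ if and only if $s_n<t<t_n$. Then for all sufficiently large $n$ the arc $\gamma_n(]s_n,t_n[)$ separates the fixed points of $f_n$ in $\mathbb D(0,r)$: the set $\mathbb D(0,r)\smallsetminus\gamma_n(]s_n,t_n[)$ has exactly two connected components, and both of them meet $\{0\}\cup\mathscr O_n$. (No hypothesis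 is made on how the multipliers $\lambda_n^q$ tend to $1$; in particular the theorem covers the case in which they do so tangentially.) -/

import Mathlib

open Filter Topology Set Metric

/-- Every orbit `z, g z, …, g^[q-1] z` starting in the closed disk of radius `r₀` stays where `g`
is holomorphic, so that `g^[q]` is holomorphic in a neighborhood of that disk.  (The values of the
total function `g` elsewhere are irrelevant.) -/
def HolomorphicIterate (g : ℂ → ℂ) (q : ℕ) (r₀ : ℝ) : Prop :=
  ∀ z ∈ closedBall (0 : ℂ) r₀, ∀ j < q, AnalyticAt ℂ g (g^[j] z)

/-- `g z = lam * z + O(z ^ 2)` has a non-degenerate parabolic fixed point at `0` whose multiplier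
`lam` is a primitive `q`-th root of unity, and `r₀` is an admissible radius for `f = g^[q]`. -/
structure IsNondegenerateParabolic (g : ℂ → ℂ) (q : ℕ) (lam : ℂ) (r₀ : ℝ) : Prop where
  q_pos : 0 < q
  primitive : IsPrimitiveRoot lam q
  radius_pos : 0 < r₀
  holomorphic : HolomorphicIterate g q r₀
  map_zero : g 0 = 0
  multiplier : deriv g 0 = lam
  /-- as a fixed point of `g^[q]`, the origin has multiplicity exactly `q + 1` -/
  nondegenerate : analyticOrderAt (fun z => g^[q] z - z) 0 = ((q + 1 : ℕ) : ℕ∞)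
  univalent : InjOn (g^[q]) (closedBall 0 r₀)
  only_fixed : ∀ z ∈ closedBall (0 : ℂ) r₀, g^[q] z = z → z = 0
  re_deriv_pos : ∀ z ∈ closedBall (0 : ℂ) r₀, 0 < (deriv (g^[q]) z).re

/-- `gn n z = lamₙ * z + O(z ^ 2)`, `|lamₙ| ≠ 1`, is a sequence of analytic perturbations of `g`. -/
structure IsPerturbation (g : ℂ → ℂ) (q : ℕ) (r₀ : ℝ) (gn : ℕ → ℂ → ℂ) : Prop where
  holomorphic : ∀ n, HolomorphicIterate (gn n) q r₀
  map_zero : ∀ n, gn n 0 = 0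
  multiplier : ∀ n, ‖deriv (gn n) 0‖ ≠ 1
  tendsto : TendstoUniformlyOn gn g atTop (closedBall 0 r₀)
  tendsto_iterate : TendstoUniformlyOn (fun n => (gn n)^[q]) (g^[q]) atTop (closedBall 0 r₀)

/-- The curve `γ : ]-∞, 0] → ℂ` is an embedded arc, invariant under `f` in the sense that
`f (γ t) = γ (t + 1)` whenever `γ t` is in the closed disk of radius `r₀` on which `f` is
considered. -/
structure IsInvariantArc (f : ℂ → ℂ) (r₀ : ℝ) (γ : ℝ → ℂ) : Prop where
  continuousOn : ContinuousOn γ (Iic 0)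
  injOn : InjOn γ (Iic 0)
  invariant : ∀ t ≤ -1, γ t ∈ closedBall (0 : ℂ) r₀ → f (γ t) = γ (t + 1)

/-- The points of the bifurcated `q`-cycle of `g`: the nonzero points of the closed disk of
radius `r₀` whose exact period under `g` is `q`.  (For a small perturbation `g` of a
non-degenerate parabolic map, `g^[q]` has exactly `q + 1` fixed points in the disk, so these points
form a single `q`-cycle and, with `0`, are all the fixed points of `g^[q]` there.) -/
def bifurcatedCycle (g : ℂ → ℂ) (q : ℕ) (r₀ : ℝ) : Set ℂ :=
  {z | z ∈ closedBall (0 : ℂ) r₀ ∧ z ≠ 0 ∧ Function.minimalPeriod g z = q}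

/-- The set of connected components of a subset of the plane. -/
def componentsOf (S : Set ℂ) : Set (Set ℂ) :=
  {C | ∃ z ∈ S, C = connectedComponentIn S z}

/-! Let `F` be the perturbed iterate, `G` its local inverse and `φ z = z - G z`, so that zeros of
`φ` in the disk are fixed points of `F`. Let the arc enter the disk at `Q = γ s` and leave it at `P
= γ t`. Along the arc, `φ (γ x)` is the chord `γ x - γ (x - 1)`; the inverse is used because the arc
need not continue beyond `P`. A component of the disk minus the arc is bounded by the arc and one of
the two circular arcs from `P` to `Q`. By the argument principle it contains a zero of `φ` as soon
as `φ` has nonzero winding along this closed curve (`crosscut_components`).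

The winding along the arc is found as in Hopf's Umlaufsatz (`log_chord_increment`). Between times `s
+ 1` and `t` the chord is deformed through longer chords to those starting at `Q` and those ending
at `P`; these lie in half-planes, because the ends are on the circle and the rest is inside. Between
`s` and `s + 1` the displacement turns by less than `1/4`: consecutive displacements are nearly
equal, so the turning over a unit step is close to one fixed multiple of `2π`, and this multiple can
be read off at any time (`abs_im_log_step_le`). At a fixed time it is inherited from the limit arc,
where it is zero: the turning of a chord over a unit step hardly depends on the length of the chord,
long chords turn like `γ`, and unit chords turn like `γ ^ (q + 1)`, so the turning of `γ` is small
(`exists_log_displacement_of_tendsto_zero`).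

On the circle `φ` behaves like `z ^ (q + 1)`, so `w = φ z / z` turns monotonically in the direction
of travel (`winding_ne_zero`). If the total winding were zero, the argument of `w`, measured in that
direction, would stay within `1/4` of `-π/2` on the way from `P` to `Q`. Then `|1 - w|` decreases.
But `|1 - w| = |G z| / r` is less than `1` at `P` and at least `1` at `Q`, since the arc is inside
the disk one step before `P` and outside it one step before `Q`.

All winding numbers are increments of continuous logarithms. -/

/-! ### Continuous logarithms and their increments -/

/-- A nonvanishing continuous function on a contractible space has a continuous logarithm. -/
theorem exists_continuous_log {X : Type*} [TopologicalSpace X] [ContractibleSpace X]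
    [LocallyPathConnectedSpace X] {F : X → ℂ} (hF : Continuous F) (h0 : ∀ x, F x ≠ 0) :
    ∃ L : X → ℂ, Continuous L ∧ ∀ x, Complex.exp (L x) = F x := by
  obtain ⟨x₀⟩ : Nonempty X := inferInstance
  obtain ⟨L, ⟨-, hL⟩, -⟩ := Complex.isCoveringMapOn_exp.existsUnique_continuousMap_lifts
    ⟨F, hF⟩ (a₀ := x₀) (Complex.exp_log (h0 x₀)) (fun x => h0 x)
  exact ⟨L, L.continuous, fun x => congrFun hL x⟩

theorem exists_continuousOn_log_Icc {a b : ℝ} (hab : a ≤ b) {F : ℝ → ℂ}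
    (hF : ContinuousOn F (Icc a b)) (h0 : ∀ x ∈ Icc a b, F x ≠ 0) :
    ∃ L : ℝ → ℂ, Continuous L ∧ ∀ x ∈ Icc a b, Complex.exp (L x) = F x := by
  obtain ⟨L, hL, h⟩ := exists_continuous_log (F := fun x => F (projIcc a b hab x))
    (hF.comp_continuous (by fun_prop) (fun x => (projIcc a b hab x).2))
    (fun x => h0 _ (projIcc a b hab x).2)
  exact ⟨L, hL, fun x hx => by rw [h, projIcc_of_mem hab hx]⟩

/-- A continuous logarithm of the constant function `1` is constant. -/
theorem IsPreconnected.eq_of_exp_eq_one {X : Type*} [TopologicalSpace X] {S : Set X}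
    (hS : IsPreconnected S) {D : X → ℂ} (hD : ContinuousOn D S)
    (h1 : ∀ x ∈ S, Complex.exp (D x) = 1) {x y : X} (hx : x ∈ S) (hy : y ∈ S) : D x = D y := by
  have hpi := Real.pi_pos
  have key : ∀ x ∈ S, ∃ n : ℤ, D x = n * (2 * Real.pi * Complex.I) := fun x hx =>
    Complex.exp_eq_one_iff.1 (h1 x hx)
  have hcont : ContinuousOn (fun x => (D x).im / (2 * Real.pi)) S :=
    (Complex.continuous_im.comp_continuousOn hD).div_const _
  have hmaps : MapsTo (fun x => (D x).im / (2 * Real.pi)) S (range ((↑) : ℤ → ℝ)) := by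
    intro x hx
    obtain ⟨n, hn⟩ := key x hx
    refine ⟨n, ?_⟩
    simp [hn]
  have hE : (D x).im / (2 * Real.pi) = (D y).im / (2 * Real.pi) := by
    refine hS.constant_of_mapsTo (T := range ((↑) : ℤ → ℝ)) ?_ hcont hmaps hx hy
    exact (Int.isClosedEmbedding_coe_real.isDiscrete_range)
  obtain ⟨n, hn⟩ := key x hx
  obtain ⟨m, hm⟩ := key y hy
  rw [hn, hm] at hE ⊢
  simp at hE
  rw [hE]

/-- Two continuous logarithms of the same function have the same increments. -/
theorem IsPreconnected.log_sub_eq {X : Type*} [TopologicalSpace X] {S : Set X}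
    (hS : IsPreconnected S) {L M : X → ℂ} (hL : ContinuousOn L S) (hM : ContinuousOn M S)
    {c : ℂ} (h : ∀ x ∈ S, Complex.exp (L x) = c * Complex.exp (M x)) {x y : X}
    (hx : x ∈ S) (hy : y ∈ S) : L y - L x = M y - M x := by
  have hc : c ≠ 0 := by
    rintro rfl
    simpa using h x hx
  have := hS.eq_of_exp_eq_one (D := fun x => L x - M x - Complex.log c)
    (by fun_prop) (fun z hz => by
      rw [Complex.exp_sub, Complex.exp_sub, h z hz, Complex.exp_log hc]
      field_simp [Complex.exp_ne_zero]) hx hy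
  linear_combination -this

/-- A continuous logarithm of a differentiable function is differentiable. -/
theorem HasDerivAt.of_exp_eq {L w : ℝ → ℂ} {w' : ℂ} {x : ℝ} (hL : ContinuousAt L x)
    (h : ∀ᶠ y in 𝓝 x, Complex.exp (L y) = w y) (hw : HasDerivAt w w' x) :
    HasDerivAt L (w' / w x) x := by
  have hx := h.self_of_nhds
  have hwx : w x ≠ 0 := hx ▸ Complex.exp_ne_zero _
  -- Near `x`, where `L` moves by less than `1 < π`, it is the principal logarithm of `w y / w x`,
  -- shifted by `L x`.
  have h1 : HasDerivAt (fun y => Complex.log (w y / w x) + L x) (w' / w x) x := by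
    have h2 : HasDerivAt (fun y => w y / w x) (w' / w x) x := hw.div_const _
    have := (h2.clog_real (by simp [div_self hwx])).add_const (L x)
    simpa [div_self hwx] using this
  refine h1.congr_of_eventuallyEq ?_
  have hsm : ∀ᶠ y in 𝓝 x, ‖L y - L x‖ < 1 := by
    have : Tendsto (fun y => ‖L y - L x‖) (𝓝 x) (𝓝 0) := by
      have := (hL.sub (continuousAt_const (y := L x))).norm
      simpa [ContinuousAt] using this
    exact this.eventually (gt_mem_nhds one_pos)
  filter_upwards [h, hsm] with y hy hy1
  have him := (Complex.abs_im_le_norm (L y - L x)).trans_lt hy1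
  have hpi := Real.pi_gt_three
  rw [abs_lt] at him
  rw [← hy, ← hx, ← Complex.exp_sub, Complex.log_exp (by linarith) (by linarith)]
  ring

theorem ContinuousOn.exists_continuous_eqOn {J : Set ℂ} (hJ : IsClosed J) {h : ℂ → ℂ}
    (hh : ContinuousOn h J) : ∃ H : ℂ → ℂ, Continuous H ∧ EqOn H h J := by
  obtain ⟨H, hH⟩ := ContinuousMap.exists_restrict_eq hJ
    ⟨J.domRestrict h, continuousOn_iff_continuous_domRestrict.1 hh⟩
  exact ⟨H, H.continuous, fun x hx => congr($hH ⟨x, hx⟩)⟩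

/-! ### Winding numbers along frontiers of plane open sets -/

/-- If a function without zeros on the closure of a bounded open set `U ∋ p` agrees on the frontier
of `U` with `(z - p) ^ k` up to a factor that has a continuous logarithm, then `k = 0`. -/
theorem exponent_eq_zero_of_frontier {U : Set ℂ} (hU : IsOpen U) (hb : Bornology.IsBounded U)
    {φ : ℂ → ℂ} (hφ : ContinuousOn φ (closure U)) (h0 : ∀ z ∈ closure U, φ z ≠ 0)
    {p : ℂ} (hp : p ∈ U) {k : ℤ} {h : ℂ → ℂ} (hh : ContinuousOn h (frontier U))
    (heq : ∀ z ∈ frontier U, φ z = (z - p) ^ k * Complex.exp (h z)) : k = 0 := by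
  classical
  obtain ⟨H, hH, hHh⟩ := hh.exists_continuous_eqOn isClosed_frontier
  set ψ : ℂ → ℂ := fun z => (z - p) ^ k * Complex.exp (H z) with hψ
  -- Gluing `φ` inside `U` to `(z - p) ^ k * exp H` outside gives a zero-free continuous function on
  -- the whole plane. It has a logarithm, so its winding along a large circle, which is `k`, must
  -- vanish.
  set F : ℂ → ℂ := fun z => if z ∈ U then φ z else ψ z with hF
  have hF1 : EqOn F φ (closure U) := by
    intro z hz
    by_cases hzU : z ∈ U
    · simp [hF, hzU]
    · have hzf : z ∈ frontier U := by rw [hU.frontier_eq]; exact ⟨hz, hzU⟩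
      simp only [hF, hzU, if_false, hψ]
      rw [heq z hzf, hHh hzf]
  have hF2 : EqOn F ψ Uᶜ := fun z hz => if_neg hz
  have hne : ∀ z ∈ Uᶜ, z - p ≠ 0 := by
    rintro z hz h
    rw [sub_eq_zero] at h
    exact hz (h ▸ hp)
  have hψc : ContinuousOn ψ Uᶜ := by
    refine ContinuousOn.mul (ContinuousOn.zpow₀ (by fun_prop) k fun z hz => Or.inl (hne z hz)) ?_
    fun_prop
  have hFc : Continuous F := by
    rw [← continuousOn_univ]
    have := (hφ.congr hF1).union_of_isClosed (hψc.congr hF2) isClosed_closure hU.isClosed_compl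
    refine this.mono fun z _ => ?_
    by_cases hz : z ∈ U
    · exact Or.inl (subset_closure hz)
    · exact Or.inr hz
  have hF0 : ∀ z, F z ≠ 0 := by
    intro z
    by_cases hz : z ∈ U
    · rw [hF1 (subset_closure hz)]
      exact h0 z (subset_closure hz)
    · rw [hF2 hz]
      exact mul_ne_zero (zpow_ne_zero _ (hne z hz)) (Complex.exp_ne_zero _)
  obtain ⟨L, hL, hLF⟩ := exists_continuous_log hFc hF0
  obtain ⟨ρ, hρ⟩ := hb.subset_ball p
  have hρ0 : 0 < ρ := by simpa using hρ hp
  set c : ℝ → ℂ := fun θ => p + ρ * Complex.exp (θ * Complex.I) with hc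
  have hcc : Continuous c := by fun_prop
  have hcU : ∀ θ, c θ ∈ Uᶜ := by
    intro θ hθ
    have := hρ hθ
    simp [hc, Complex.norm_exp_ofReal_mul_I, abs_of_pos hρ0] at this
  have hend : c (2 * Real.pi) = c 0 := by simp [hc, Complex.exp_two_pi_mul_I]
  have := isPreconnected_univ.log_sub_eq (S := univ) (L := fun θ : ℝ => L (c θ))
    (M := fun θ : ℝ => H (c θ) + k * (θ * Complex.I)) (c := (ρ : ℂ) ^ k) (by fun_prop)
    (by fun_prop) (fun θ _ => by
      rw [hLF, hF2 (hcU θ), Complex.exp_add, Complex.exp_int_mul]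
      simp only [hψ]
      rw [show c θ - p = ρ * Complex.exp (θ * Complex.I) by simp [hc], mul_zpow]
      ring) (mem_univ 0) (mem_univ (2 * Real.pi))
  simp only [hend] at this
  have h3 : (k : ℂ) * (2 * Real.pi * Complex.I) = 0 := by
    push_cast at this
    linear_combination -this
  simpa [Real.pi_ne_zero] using h3

/-- A continuous function of the parameter of an arc is the restriction of a continuous function
on the plane. -/
theorem exists_continuous_comp_arc {a b : ℝ} {e : ℝ → ℂ} (he : ContinuousOn e (Icc a b))
    (hinj : InjOn e (Icc a b)) {L : ℝ → ℂ} (hL : ContinuousOn L (Icc a b)) :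
    ∃ H : ℂ → ℂ, Continuous H ∧ ∀ x ∈ Icc a b, H (e x) = L x := by
  have h1 : IsClosedEmbedding ((Icc a b).domRestrict e) :=
    (continuousOn_iff_continuous_domRestrict.1 he).isClosedEmbedding (injOn_iff_injective.1 hinj)
  obtain ⟨H, hH⟩ := ContinuousMap.exists_extension' h1
    ⟨(Icc a b).domRestrict L, continuousOn_iff_continuous_domRestrict.1 hL⟩
  exact ⟨H, H.continuous, fun x hx => congrFun hH ⟨x, hx⟩⟩

/-- A function without zeros on the closure of a bounded open set whose frontier is covered by two
arcs with common endpoints has winding number zero along the closed curve they form. -/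
theorem winding_eq_zero_of_frontier {a b a' b' : ℝ} (hab : a ≤ b) (hab' : a' ≤ b') {e c : ℝ → ℂ}
    (he : ContinuousOn e (Icc a b)) (hei : InjOn e (Icc a b))
    (hc : ContinuousOn c (Icc a' b')) (hci : InjOn c (Icc a' b'))
    (hend : e a = c b') (hend' : e b = c a')
    (hmeet : ∀ x ∈ Icc a b, ∀ y ∈ Icc a' b', e x = c y → x = a ∧ y = b' ∨ x = b ∧ y = a')
    {U : Set ℂ} (hU : IsOpen U) (hb : Bornology.IsBounded U) (hne : U.Nonempty)
    (hfr : frontier U ⊆ e '' Icc a b ∪ c '' Icc a' b')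
    (hdis : Disjoint U (e '' Icc a b ∪ c '' Icc a' b'))
    {φ : ℂ → ℂ} (hφ : ContinuousOn φ (closure U)) (h0 : ∀ z ∈ closure U, φ z ≠ 0)
    {Le Lc : ℝ → ℂ} (hLe : ContinuousOn Le (Icc a b)) (hLc : ContinuousOn Lc (Icc a' b'))
    (hLe' : ∀ x ∈ Icc a b, Complex.exp (Le x) = φ (e x))
    (hLc' : ∀ x ∈ Icc a' b', Complex.exp (Lc x) = φ (c x)) :
    Lc b' - Lc a' + (Le b - Le a) = 0 := by
  obtain ⟨p, hp⟩ := hne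
  have hpe : ∀ x ∈ Icc a b, e x - p ≠ 0 := fun x hx h =>
    disjoint_left.1 hdis hp (Or.inl ⟨x, hx, sub_eq_zero.1 h⟩)
  have hpc : ∀ x ∈ Icc a' b', c x - p ≠ 0 := fun x hx h =>
    disjoint_left.1 hdis hp (Or.inr ⟨x, hx, sub_eq_zero.1 h⟩)
  obtain ⟨Me, hMe, hMe'⟩ := exists_continuousOn_log_Icc hab (F := fun x => e x - p) (by fun_prop) hpe
  obtain ⟨Mc, hMc, hMc'⟩ := exists_continuousOn_log_Icc hab' (F := fun x => c x - p) (by fun_prop) hpc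
  have hla := left_mem_Icc.2 hab
  have hrb := right_mem_Icc.2 hab
  have hla' := left_mem_Icc.2 hab'
  have hrb' := right_mem_Icc.2 hab'
  have hk : ∃ k : ℤ, Lc b' - Lc a' + (Le b - Le a) = k * (2 * Real.pi * Complex.I) := by
    refine Complex.exp_eq_one_iff.1 ?_
    have h1 := Complex.exp_ne_zero (Lc a')
    have h2 := Complex.exp_ne_zero (Le a)
    rw [Complex.exp_add, Complex.exp_sub, Complex.exp_sub]
    rw [hLc' _ hrb', hLc' _ hla', hLe' _ hla, hLe' _ hrb, hend, hend'] at *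
    field_simp
  have hm : ∃ m : ℤ, Mc b' - Mc a' + (Me b - Me a) = m * (2 * Real.pi * Complex.I) := by
    refine Complex.exp_eq_one_iff.1 ?_
    have h1 := Complex.exp_ne_zero (Mc a')
    have h2 := Complex.exp_ne_zero (Me a)
    rw [Complex.exp_add, Complex.exp_sub, Complex.exp_sub]
    rw [hMc' _ hrb', hMc' _ hla', hMe' _ hla, hMe' _ hrb, hend, hend'] at *
    field_simp
  obtain ⟨k, hk⟩ := hk
  obtain ⟨m, hm⟩ := hm
  -- Here `k` and `m` are the windings of `φ` and of `z - p`. The winding of `φ ^ m / (z - p) ^ k`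
  -- is `m k - k m = 0`, so it has a single-valued logarithm on the closed curve, and
  -- `exponent_eq_zero_of_frontier` gives `k = 0` whatever `m` is. The constant `κ` makes the two
  -- branches agree at `e b = c a'`; at the other endpoint they then agree by this cancellation.
  set κ : ℂ := (m * Le b - k * Me b) - (m * Lc a' - k * Mc a') with hκ
  have hexpκ : Complex.exp κ = 1 := by
    have e1 : Complex.exp (Le b) = Complex.exp (Lc a') := by rw [hLe' _ hrb, hLc' _ hla', hend']
    have e2 : Complex.exp (Me b) = Complex.exp (Mc a') := by rw [hMe' _ hrb, hMc' _ hla', hend']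
    rw [hκ, Complex.exp_sub, Complex.exp_sub, Complex.exp_sub]
    simp only [Complex.exp_int_mul]
    rw [e1, e2]
    exact div_self (div_ne_zero (zpow_ne_zero _ (Complex.exp_ne_zero _))
      (zpow_ne_zero _ (Complex.exp_ne_zero _)))
  obtain ⟨He, hHe, hHe'⟩ := exists_continuous_comp_arc he hei
    (L := fun x => m * Le x - k * Me x) (by fun_prop)
  obtain ⟨Hc, hHc, hHc'⟩ := exists_continuous_comp_arc hc hci
    (L := fun x => m * Lc x - k * Mc x + κ) (by fun_prop)
  classical
  set h : ℂ → ℂ := fun z => if z ∈ e '' Icc a b then He z else Hc z with hh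
  have hce : EqOn h He (e '' Icc a b) := fun z hz => if_pos hz
  have hcc : EqOn h Hc (c '' Icc a' b') := by
    rintro z ⟨y, hy, rfl⟩
    by_cases hz : c y ∈ e '' Icc a b
    · rw [hce hz]
      obtain ⟨x, hx, hxy⟩ := hz
      rw [hHc' y hy, ← hxy, hHe' x hx]
      rcases hmeet x hx y hy hxy with ⟨rfl, rfl⟩ | ⟨rfl, rfl⟩
      · rw [hκ]
        linear_combination (k : ℂ) * hm - (m : ℂ) * hk
      · rw [hκ]; ring
    · exact if_neg hz
  have hcont : ContinuousOn h (e '' Icc a b ∪ c '' Icc a' b') :=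
    (hHe.continuousOn.congr hce).union_of_isClosed (hHc.continuousOn.congr hcc)
      (isCompact_Icc.image_of_continuousOn he).isClosed
      (isCompact_Icc.image_of_continuousOn hc).isClosed
  have hk0 : k = 0 := by
    refine exponent_eq_zero_of_frontier hU hb (φ := fun z => φ z ^ m)
      (hφ.zpow₀ m fun z hz => Or.inl (h0 z hz)) (fun z hz => zpow_ne_zero _ (h0 z hz)) hp
      (hcont.mono hfr) ?_
    intro z hz
    rcases hfr hz with hz | hz
    · rw [hce hz]
      obtain ⟨x, hx, rfl⟩ := hz
      rw [hHe' x hx, Complex.exp_sub, Complex.exp_int_mul, Complex.exp_int_mul, hLe' x hx,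
        hMe' x hx]
      exact (mul_div_cancel₀ _ (zpow_ne_zero _ (hpe x hx))).symm
    · rw [hcc hz]
      obtain ⟨x, hx, rfl⟩ := hz
      rw [hHc' x hx, Complex.exp_add, hexpκ, mul_one, Complex.exp_sub, Complex.exp_int_mul,
        Complex.exp_int_mul, hLc' x hx, hMc' x hx]
      exact (mul_div_cancel₀ _ (zpow_ne_zero _ (hpc x hx))).symm
  rw [hk, hk0]
  simp

/-- If `p` and `q` are close to each other, compared with their distance to `K`, then
`(z - p) / (z - q)` has a continuous logarithm on `K`. -/
theorem exists_log_ratio_of_near {K : Set ℂ} {p q : ℂ} (h : ∀ z ∈ K, ‖q - p‖ < ‖z - q‖) :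
    ∃ h : ℂ → ℂ, ContinuousOn h K ∧ ∀ z ∈ K, z - p = (z - q) * Complex.exp (h z) := by
  have hne : ∀ z ∈ K, z - q ≠ 0 := fun z hz => norm_pos_iff.1 ((norm_nonneg _).trans_lt (h z hz))
  have hslit : ∀ z ∈ K, 1 + (q - p) / (z - q) ∈ Complex.slitPlane := by
    intro z hz
    refine Complex.mem_slitPlane_of_norm_lt_one ?_
    rw [norm_div, div_lt_one (norm_pos_iff.2 (hne z hz))]
    exact h z hz
  refine ⟨fun z => Complex.log (1 + (q - p) / (z - q)), ?_, fun z hz => ?_⟩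
  · refine ContinuousOn.clog ?_ hslit
    exact continuousOn_const.add (continuousOn_const.div (by fun_prop) hne)
  · rw [Complex.exp_log (Complex.slitPlane_ne_zero (hslit z hz))]
    have := hne z hz
    field_simp
    ring

/-- If `p` and `q` lie in a connected set disjoint from the closed set `K`, then
`(z - p) / (z - q)` has a continuous logarithm on `K`. -/
theorem IsPreconnected.exists_log_ratio {Ω K : Set ℂ} (hΩ : IsPreconnected Ω) (hK : IsClosed K)
    (hd : Disjoint Ω K) {p q : ℂ} (hp : p ∈ Ω) (hq : q ∈ Ω) :
    ∃ h : ℂ → ℂ, ContinuousOn h K ∧ ∀ z ∈ K, z - p = (z - q) * Complex.exp (h z) := by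
  refine hΩ.induction₂ (fun p q => ∃ h : ℂ → ℂ, ContinuousOn h K ∧
    ∀ z ∈ K, z - p = (z - q) * Complex.exp (h z)) ?_ ?_ ?_ hp hq
  · intro x hx
    have hxK : x ∈ Kᶜ := disjoint_left.1 hd hx
    obtain ⟨δ, hδ, hball⟩ := Metric.isOpen_iff.1 hK.isOpen_compl x hxK
    refine mem_nhdsWithin_of_mem_nhds ?_
    filter_upwards [ball_mem_nhds x (half_pos hδ)] with y hy
    refine exists_log_ratio_of_near fun z hz => ?_
    have h1 : δ ≤ ‖z - x‖ := by
      by_contra! hlt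
      exact hball (mem_ball_iff_norm.2 hlt) hz
    have h2 : ‖y - x‖ < δ / 2 := mem_ball_iff_norm.1 hy
    have h3 : ‖z - x‖ ≤ ‖z - y‖ + ‖y - x‖ := norm_sub_le_norm_sub_add_norm_sub z y x
    linarith
  · rintro x y z - - - ⟨h, hh, he⟩ ⟨h', hh', he'⟩
    refine ⟨fun w => h w + h' w, hh.add hh', fun w hw => ?_⟩
    rw [he w hw, he' w hw, Complex.exp_add]
    ring
  · rintro x y - - ⟨h, hh, he⟩
    refine ⟨fun w => -h w, hh.neg, fun w hw => ?_⟩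
    rw [he w hw, mul_assoc, ← Complex.exp_add]
    simp

/-! ### Components of a disk cut by an arc -/

/-- The component of a frontier point lying in `S` would be an open neighborhood meeting the given
component, hence equal to it; but an open set misses its frontier. -/
theorem frontier_connectedComponentIn_disjoint {S : Set ℂ} (hS : IsOpen S) (z : ℂ) :
    Disjoint (frontier (connectedComponentIn S z)) S := by
  rw [disjoint_left]
  intro w hw hwS
  have hopen : IsOpen (connectedComponentIn S z) := hS.connectedComponentIn
  rw [hopen.frontier_eq] at hw
  obtain ⟨y, hy, hyz⟩ := mem_closure_iff.1 hw.1 _ (hS.connectedComponentIn (x := w))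
    (mem_connectedComponentIn hwS)
  refine hw.2 ?_
  rw [connectedComponentIn_eq hyz, ← connectedComponentIn_eq hy]
  exact mem_connectedComponentIn hwS

/-- An arc does not cut off a component of a disk from its boundary circle. -/
theorem exists_mem_closure_component_sphere {r a b : ℝ} (hab : a ≤ b) {e : ℝ → ℂ}
    (he : ContinuousOn e (Icc a b)) (hei : InjOn e (Icc a b)) {z : ℂ}
    (hz : z ∈ ball (0 : ℂ) r \ e '' Icc a b) :
    ∃ w ∈ closure (connectedComponentIn (ball (0 : ℂ) r \ e '' Icc a b) z),
      w ∈ sphere (0 : ℂ) r ∧ w ∉ e '' Icc a b := by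
  set S := ball (0 : ℂ) r \ e '' Icc a b with hS
  have hE : IsClosed (e '' Icc a b) := (isCompact_Icc.image_of_continuousOn he).isClosed
  have hSo : IsOpen S := isOpen_ball.sdiff hE
  by_contra! hcon
  set C := connectedComponentIn S z with hC
  have hCS : C ⊆ S := connectedComponentIn_subset S z
  have hfr : frontier C ⊆ e '' Icc a b := by
    intro w hw
    have hwS := disjoint_left.1 (frontier_connectedComponentIn_disjoint hSo z) hw
    have hwc : w ∈ closure C := frontier_subset_closure hw
    have hwb : w ∈ closedBall (0 : ℂ) r :=
      closure_minimal (hCS.trans (sdiff_subset.trans ball_subset_closedBall)) isClosed_closedBall hwc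
    by_contra hwE
    rcases (mem_closedBall.1 hwb).eq_or_lt with h | h
    · exact hwE (hcon w hwc (mem_sphere.2 h))
    · exact hwS ⟨h, hwE⟩
  have hne : ∀ x ∈ Icc a b, e x - z ≠ 0 := fun x hx h => hz.2 ⟨x, hx, sub_eq_zero.1 h⟩
  obtain ⟨M, hM, hM'⟩ := exists_continuousOn_log_Icc hab (F := fun x => e x - z) (by fun_prop) hne
  obtain ⟨H, hH, hH'⟩ := exists_continuous_comp_arc he hei hM.continuousOn
  -- With the frontier contained in the arc, `e x - z` has a logarithm there, so the constant `1`
  -- equals `(w - z) ^ 1` times an exponential, against exponent zero.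
  have := exponent_eq_zero_of_frontier (U := C) hSo.connectedComponentIn
    (isBounded_ball.subset (hCS.trans sdiff_subset)) (φ := fun _ => 1) continuousOn_const
    (fun _ _ => one_ne_zero) (mem_connectedComponentIn hz) (k := 1) (h := fun w => -H w)
    hH.neg.continuousOn (by
      intro w hw
      obtain ⟨x, hx, rfl⟩ := hfr hw
      rw [hH' x hx, Complex.exp_neg, hM' x hx, zpow_one, mul_inv_cancel₀ (hne x hx)])
  exact one_ne_zero this

/-- Points of a disk near an open arc of its boundary circle that does not meet the closed set `E`
are in one component of the complement of `E`. -/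
theorem exists_component_touching_arc {r α : ℝ} (hr : 0 < r) (hα : 0 < α) {E : Set ℂ}
    (hE : IsClosed E) (hEne : E.Nonempty) {c : ℝ → ℂ} (hc : Continuous c)
    (hcr : ∀ θ, c θ ∈ sphere (0 : ℂ) r) (hcE : ∀ θ ∈ Ioo 0 α, c θ ∉ E) :
    ∃ z₀ ∈ ball (0 : ℂ) r \ E, c (α / 2) ∈ closure (connectedComponentIn (ball (0 : ℂ) r \ E) z₀) ∧
      ∀ z, ∀ θ ∈ Ioo 0 α, c θ ∈ closure (connectedComponentIn (ball (0 : ℂ) r \ E) z) →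
        connectedComponentIn (ball (0 : ℂ) r \ E) z =
          connectedComponentIn (ball (0 : ℂ) r \ E) z₀ := by
  set S := ball (0 : ℂ) r \ E with hS
  set d : ℝ → ℝ := fun θ => infDist (c θ) E with hd
  have hd0 : ∀ θ ∈ Ioo 0 α, 0 < d θ := fun θ hθ =>
    (hE.notMem_iff_infDist_pos hEne).1 (hcE θ hθ)
  -- The path `β` is the boundary arc pushed radially inwards by at most half the distance to `E`.
  -- It stays in the convex lenses `V θ`, so it links all of them within one component.
  set u : ℝ → ℝ := fun θ => min (d θ / (2 * r)) (1 / 2) with hu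
  have hu0 : ∀ θ ∈ Ioo 0 α, 0 < u θ := fun θ hθ =>
    lt_min (div_pos (hd0 θ hθ) (by positivity)) (by norm_num)
  have hu1 : ∀ θ, u θ ≤ 1 / 2 := fun θ => min_le_right _ _
  set β : ℝ → ℂ := fun θ => ((1 - u θ : ℝ) : ℂ) * c θ with hβ
  have hdc : Continuous d := (continuous_infDist_pt E).comp hc
  have hβc : Continuous β := by
    simp only [hβ, hu]
    fun_prop
  set V : ℝ → Set ℂ := fun θ => ball (c θ) (d θ) ∩ ball 0 r with hV
  have hVS : ∀ θ, V θ ⊆ S := by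
    rintro θ w ⟨hw, hw'⟩
    refine ⟨hw', fun hwE => ?_⟩
    have h1 : infDist (c θ) E ≤ dist (c θ) w := infDist_le_dist_of_mem hwE
    rw [mem_ball, dist_comm] at hw
    exact absurd hw (not_lt.2 h1)
  have hVp : ∀ θ, IsPreconnected (V θ) := fun θ =>
    ((convex_ball _ _).inter (convex_ball _ _)).isPreconnected
  have hnc : ∀ θ, ‖c θ‖ = r := fun θ => by simpa using hcr θ
  have hβV : ∀ θ ∈ Ioo 0 α, β θ ∈ V θ := by
    intro θ hθ
    have h0 := hu0 θ hθ
    have h1 := hu1 θ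
    refine ⟨?_, ?_⟩
    · rw [mem_ball_iff_norm]
      have : β θ - c θ = -((u θ : ℝ) : ℂ) * c θ := by simp only [hβ]; push_cast; ring
      rw [this, norm_mul, norm_neg, Complex.norm_real, hnc, Real.norm_eq_abs, abs_of_pos h0]
      have h2 : u θ ≤ d θ / (2 * r) := min_le_left _ _
      have h3 : u θ * r ≤ d θ / (2 * r) * r := by gcongr
      have h4 : d θ / (2 * r) * r = d θ / 2 := by field_simp
      have := hd0 θ hθ
      linarith
    · rw [mem_ball_zero_iff]
      simp only [hβ]
      rw [norm_mul, Complex.norm_real, hnc, Real.norm_eq_abs, abs_of_pos (by linarith)]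
      nlinarith
  have hmid : α / 2 ∈ Ioo 0 α := ⟨by linarith, by linarith⟩
  have hB : IsPreconnected (β '' Ioo 0 α) := isPreconnected_Ioo.image _ hβc.continuousOn
  have hBS : β '' Ioo 0 α ⊆ S := by
    rintro _ ⟨θ, hθ, rfl⟩
    exact hVS θ (hβV θ hθ)
  refine ⟨β (α / 2), hVS _ (hβV _ hmid), ?_, ?_⟩
  · have h1 : V (α / 2) ⊆ connectedComponentIn S (β (α / 2)) :=
      (hVp _).subset_connectedComponentIn (hβV _ hmid) (hVS _)
    refine closure_mono h1 (isOpen_ball.inter_closure ⟨mem_ball_self (hd0 _ hmid), ?_⟩)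
    rw [closure_ball _ hr.ne']
    exact sphere_subset_closedBall (hcr _)
  · intro z θ hθ hcl
    obtain ⟨y, hy, hyz⟩ := mem_closure_iff.1 hcl _ isOpen_ball (mem_ball_self (hd0 θ hθ))
    have hyS : y ∈ S := connectedComponentIn_subset S z hyz
    have hyV : y ∈ V θ := ⟨hy, hyS.1⟩
    have h1 : β θ ∈ connectedComponentIn S y :=
      (hVp θ).subset_connectedComponentIn hyV (hVS θ) (hβV θ hθ)
    have h2 : β θ ∈ connectedComponentIn S (β (α / 2)) :=
      hB.subset_connectedComponentIn ⟨_, hmid, rfl⟩ hBS ⟨_, hθ, rfl⟩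
    rw [connectedComponentIn_eq hyz, connectedComponentIn_eq h1, connectedComponentIn_eq h2]

theorem isPreconnected_norm_gt (r : ℝ) : IsPreconnected {z : ℂ | r < ‖z‖} := by
  have : {z : ℂ | r < ‖z‖} = (fun x : ℝ × ℝ => (x.1 : ℂ) * Complex.exp (x.2 * Complex.I)) ''
      (Ioi r ×ˢ univ) := by
    ext z
    constructor
    · intro hz
      exact ⟨(‖z‖, z.arg), ⟨hz, mem_univ _⟩, Complex.norm_mul_exp_arg_mul_I z⟩
    · rintro ⟨⟨ρ, θ⟩, ⟨hρ, -⟩, rfl⟩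
      have h1 : r < ρ := hρ
      simp only [mem_ofPred_eq, norm_mul, Complex.norm_exp_ofReal_mul_I, Complex.norm_real, mul_one]
      exact h1.trans_le (le_abs_self ρ)
  rw [this]
  exact (isPreconnected_Ioi.prod isPreconnected_univ).image _ (by fun_prop)

/-- A connected set joining two complementary arcs of the boundary circle of a disk meets every
continuum that contains the common endpoints of these arcs. -/
theorem not_preconnected_joining_arcs {r : ℝ} (hr : 0 < r) {E A₁ A₂ C : Set ℂ}
    (hE : IsClosed E) (hEp : IsPreconnected E) (hEne : E.Nonempty)
    (hEb : E ⊆ closedBall 0 r) (hA₁ : IsClosed A₁) (hA₂ : IsClosed A₂)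
    (hA : sphere (0 : ℂ) r = A₁ ∪ A₂) (hAE : A₁ ∩ A₂ ⊆ E)
    (hC : IsPreconnected C) (hCS : C ⊆ ball 0 r \ E) {w₁ w₂ : ℂ} (hw₁ : w₁ ∈ closure C)
    (hw₂ : w₂ ∈ closure C) (h₁ : w₁ ∈ A₁) (h₂ : w₂ ∈ A₂) (h₁E : w₁ ∉ E) (h₂E : w₂ ∉ E) : False := by
  have hK₁ : IsClosed (E ∪ A₁) := hE.union hA₁
  have hK₂ : IsClosed (E ∪ A₂) := hE.union hA₂
  have hw₁K : w₁ ∈ (E ∪ A₂)ᶜ := by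
    rintro (h | h)
    · exact h₁E h
    · exact h₁E (hAE ⟨h₁, h⟩)
  have hw₂K : w₂ ∈ (E ∪ A₁)ᶜ := by
    rintro (h | h)
    · exact h₂E h
    · exact h₂E (hAE ⟨h, h₂⟩)
  obtain ⟨δ₁, hδ₁, hb₁⟩ := Metric.isOpen_iff.1 hK₂.isOpen_compl w₁ hw₁K
  obtain ⟨δ₂, hδ₂, hb₂⟩ := Metric.isOpen_iff.1 hK₁.isOpen_compl w₂ hw₂K
  have hout : ∀ w ∈ sphere (0 : ℂ) r, ∀ δ > 0, ∃ y ∈ ball w δ, r < ‖y‖ := by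
    intro w hw δ hδ
    have hwr : ‖w‖ = r := by simpa using hw
    refine ⟨((1 + δ / (2 * r) : ℝ) : ℂ) * w, ?_, ?_⟩
    · rw [mem_ball_iff_norm]
      have : ((1 + δ / (2 * r) : ℝ) : ℂ) * w - w = ((δ / (2 * r) : ℝ) : ℂ) * w := by
        push_cast; ring
      rw [this, norm_mul, Complex.norm_real, hwr, Real.norm_eq_abs, abs_of_pos (by positivity)]
      have : δ / (2 * r) * r = δ / 2 := by field_simp
      linarith
    · rw [norm_mul, Complex.norm_real, hwr, Real.norm_eq_abs, abs_of_pos (by positivity)]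
      have : (1 + δ / (2 * r)) * r = r + δ / 2 := by field_simp
      linarith
  have hs₁ : w₁ ∈ sphere (0 : ℂ) r := hA ▸ Or.inl h₁
  have hs₂ : w₂ ∈ sphere (0 : ℂ) r := hA ▸ Or.inr h₂
  obtain ⟨p, hp, hpC⟩ := mem_closure_iff.1 hw₁ _ isOpen_ball (mem_ball_self hδ₁)
  obtain ⟨p', hp', hpC'⟩ := mem_closure_iff.1 hw₂ _ isOpen_ball (mem_ball_self hδ₂)
  obtain ⟨y, hy, hyr⟩ := hout w₁ hs₁ δ₁ hδ₁
  obtain ⟨y', hy', hyr'⟩ := hout w₂ hs₂ δ₂ hδ₂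
  -- The points `p` inside and `y` outside the circle are joined in two ways: through the small ball
  -- at `w₁`, avoiding `E ∪ A₂`, and through `C`, the ball at `w₂` and the exterior, avoiding `E ∪
  -- A₁`. Each way gives a logarithm of `(z - p) / (z - y)`. The two differ by a constant on the
  -- connected set `E`, so they glue to a logarithm on the circle, where the winding is in fact `1`.
  obtain ⟨g₂, hg₂, hg₂'⟩ := (convex_ball w₁ δ₁).isPreconnected.exists_log_ratio hK₂
    (disjoint_left.2 fun z hz => hb₁ hz) hp hy
  have hΩ : IsPreconnected ((C ∪ ball w₂ δ₂) ∪ {z : ℂ | r < ‖z‖}) :=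
    (hC.union p' hpC' hp' (convex_ball w₂ δ₂).isPreconnected).union y' (Or.inr hy') hyr'
      (isPreconnected_norm_gt r)
  have hKb : E ∪ A₁ ⊆ closedBall 0 r :=
    union_subset hEb (fun z hz => sphere_subset_closedBall (hA ▸ Or.inl hz))
  have hΩd : Disjoint ((C ∪ ball w₂ δ₂) ∪ {z : ℂ | r < ‖z‖}) (E ∪ A₁) := by
    rw [disjoint_left]
    rintro z ((hz | hz) | hz) hzK
    · have hzS := hCS hz
      rcases hzK with hzK | hzK
      · exact hzS.2 hzK
      · have : z ∈ sphere (0 : ℂ) r := hA ▸ Or.inl hzK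
        exact absurd (mem_ball.1 hzS.1) (mem_sphere.1 this).not_lt
    · exact hb₂ hz hzK
    · exact absurd hz (not_lt.2 (by simpa using hKb hzK))
  obtain ⟨g₁, hg₁, hg₁'⟩ := hΩ.exists_log_ratio hK₁ hΩd (Or.inl (Or.inl hpC)) (Or.inr hyr)
  obtain ⟨x₀, hx₀⟩ := hEne
  have hyK : ∀ z ∈ closedBall (0 : ℂ) r, z - y ≠ 0 := by
    rintro z hz h
    rw [sub_eq_zero] at h
    rw [mem_closedBall_zero_iff, h] at hz
    linarith
  have hconst : ∀ z ∈ E, g₁ z - g₂ z = g₁ x₀ - g₂ x₀ := by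
    intro z hz
    refine hEp.eq_of_exp_eq_one (D := fun z => g₁ z - g₂ z)
      ((hg₁.mono subset_union_left).sub (hg₂.mono subset_union_left)) (fun w hw => ?_) hz hx₀
    have e1 := (hg₁' w (Or.inl hw)).symm.trans (hg₂' w (Or.inl hw))
    have e2 := mul_left_cancel₀ (hyK w (hEb hw)) e1
    rw [Complex.exp_sub, e2, div_self (Complex.exp_ne_zero _)]
  have hexp : Complex.exp (g₁ x₀ - g₂ x₀) = 1 := by
    have e1 := (hg₁' x₀ (Or.inl hx₀)).symm.trans (hg₂' x₀ (Or.inl hx₀))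
    have e2 := mul_left_cancel₀ (hyK x₀ (hEb hx₀)) e1
    rw [Complex.exp_sub, e2, div_self (Complex.exp_ne_zero _)]
  classical
  set g : ℂ → ℂ := fun z => if z ∈ E ∪ A₁ then g₁ z else g₂ z + (g₁ x₀ - g₂ x₀) with hg
  have hgK₁ : EqOn g g₁ (E ∪ A₁) := fun z hz => if_pos hz
  have hgK₂ : EqOn g (fun z => g₂ z + (g₁ x₀ - g₂ x₀)) (E ∪ A₂) := by
    intro z hz
    by_cases hz1 : z ∈ E ∪ A₁
    · rw [hgK₁ hz1]
      have hzE : z ∈ E := by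
        rcases hz with h | h
        · exact h
        · rcases hz1 with h' | h'
          · exact h'
          · exact hAE ⟨h', h⟩
      have := hconst z hzE
      simp only
      linear_combination this
    · exact if_neg hz1
  have hgc : ContinuousOn g ((E ∪ A₁) ∪ (E ∪ A₂)) :=
    (hg₁.congr hgK₁).union_of_isClosed ((hg₂.add continuousOn_const).congr hgK₂) hK₁ hK₂
  have hsub : sphere (0 : ℂ) r ⊆ (E ∪ A₁) ∪ (E ∪ A₂) := by
    rw [hA]
    rintro z (hz | hz)
    · exact Or.inl (Or.inr hz)
    · exact Or.inr (Or.inr hz)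
  have hge : ∀ z ∈ sphere (0 : ℂ) r, z - p = (z - y) * Complex.exp (g z) := by
    intro z hz
    rcases hsub hz with h | h
    · rw [hgK₁ h, hg₁' z h]
    · rw [hgK₂ h, hg₂' z h, Complex.exp_add, hexp, mul_one]
  have := exponent_eq_zero_of_frontier (U := ball (0 : ℂ) r) isOpen_ball isBounded_ball
    (φ := fun z => z - y) (by fun_prop) (by
      rw [closure_ball _ hr.ne']
      exact hyK) (hCS hpC).1 (k := 1) (h := fun z => -g z) (by
      rw [frontier_ball _ hr.ne']
      exact (hgc.mono hsub).neg) (by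
      rw [frontier_ball _ hr.ne']
      intro z hz
      rw [zpow_one, hge z hz, mul_assoc, ← Complex.exp_add]
      simp)
  exact one_ne_zero this

/-! ### Circular arcs and crosscuts -/

/-- The circular arc about the origin that starts at `P`, at angular speed `σ`. -/
noncomputable def circularArc (P : ℂ) (σ θ : ℝ) : ℂ := P * Complex.exp ((σ * θ : ℝ) * Complex.I)

theorem continuous_circularArc (P : ℂ) (σ : ℝ) : Continuous (circularArc P σ) := by
  unfold circularArc
  fun_prop

theorem norm_circularArc (P : ℂ) (σ θ : ℝ) : ‖circularArc P σ θ‖ = ‖P‖ := by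
  rw [circularArc, norm_mul, Complex.norm_exp_ofReal_mul_I, mul_one]

theorem circularArc_zero (P : ℂ) (σ : ℝ) : circularArc P σ 0 = P := by simp [circularArc]

theorem circularArc_eq_iff {P : ℂ} (hP : P ≠ 0) {σ σ' θ θ' : ℝ} :
    circularArc P σ θ = circularArc P σ' θ' ↔ ∃ n : ℤ, σ * θ = σ' * θ' + n * (2 * Real.pi) := by
  rw [circularArc, circularArc, mul_right_inj' hP, Complex.exp_eq_exp_iff_exists_int]
  refine exists_congr fun n => ?_
  have : ((σ * θ : ℝ) : ℂ) * Complex.I = ((σ' * θ' : ℝ) : ℂ) * Complex.I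
      + n * (2 * Real.pi * Complex.I) ↔
      (((σ * θ : ℝ) : ℂ)) = ((σ' * θ' + n * (2 * Real.pi) : ℝ) : ℂ) := by
    constructor
    · intro h
      have h2 : (((σ * θ : ℝ) : ℂ)) * Complex.I
          = ((σ' * θ' + n * (2 * Real.pi) : ℝ) : ℂ) * Complex.I := by
        rw [h]; push_cast; ring
      exact mul_right_cancel₀ Complex.I_ne_zero h2
    · intro h
      rw [h]; push_cast; ring
  rw [this, Complex.ofReal_inj]

theorem int_eq_zero_of_mul_two_pi {x : ℝ} {n : ℤ} (h : x = n * (2 * Real.pi))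
    (h1 : -(2 * Real.pi) < x) (h2 : x < 2 * Real.pi) : n = 0 := by
  have hpi := Real.pi_pos
  have h3 : (n : ℝ) < 1 := by nlinarith
  have h4 : (-1 : ℝ) < n := by nlinarith
  have h5 : n < 1 := by exact_mod_cast h3
  have h6 : -1 < n := by exact_mod_cast h4
  omega

theorem injOn_circularArc {P : ℂ} (hP : P ≠ 0) {σ : ℝ} (hσ : σ = 1 ∨ σ = -1) {α : ℝ}
    (hα : α < 2 * Real.pi) : InjOn (circularArc P σ) (Icc 0 α) := by
  intro x hx y hy h
  obtain ⟨n, hn⟩ := (circularArc_eq_iff hP).1 h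
  have hn0 : n = 0 := by
    refine int_eq_zero_of_mul_two_pi (x := σ * x - σ * y) (by linarith) ?_ ?_ <;>
    rcases hσ with rfl | rfl <;> linarith [hx.1, hx.2, hy.1, hy.2]
  rw [hn0] at hn
  rcases hσ with rfl | rfl <;> push_cast at hn <;> linarith

theorem sphere_eq_union_circularArc {P : ℂ} {r : ℝ} (hr : 0 < r) (hP : ‖P‖ = r) {α : ℝ}
    (hα : 0 < α) (hα' : α < 2 * Real.pi) :
    sphere (0 : ℂ) r = circularArc P 1 '' Icc 0 α ∪ circularArc P (-1) '' Icc 0 (2 * Real.pi - α) := by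
  have hP0 : P ≠ 0 := norm_pos_iff.1 (hP ▸ hr)
  refine Subset.antisymm ?_ ?_
  · intro z hz
    have hzr : ‖z‖ = r := by simpa using hz
    have hz1 : ‖z / P‖ = 1 := by rw [norm_div, hzr, hP, div_self hr.ne']
    obtain ⟨θ, hθ0, hθ1, hθ⟩ : ∃ θ : ℝ, 0 ≤ θ ∧ θ < 2 * Real.pi ∧ z = circularArc P 1 θ := by
      have h1 : z = circularArc P 1 (z / P).arg := by
        have := Complex.norm_mul_exp_arg_mul_I (z / P)
        rw [hz1, Complex.ofReal_one, one_mul] at this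
        rw [circularArc, one_mul, this, mul_div_cancel₀ _ hP0]
      have h2 := Complex.neg_pi_lt_arg (z / P)
      have h3 := Complex.arg_le_pi (z / P)
      have hpi := Real.pi_pos
      by_cases h4 : 0 ≤ (z / P).arg
      · exact ⟨_, h4, by linarith, h1⟩
      · refine ⟨(z / P).arg + 2 * Real.pi, by linarith, by linarith, h1.trans ?_⟩
        rw [circularArc_eq_iff hP0]
        exact ⟨-1, by push_cast; ring⟩
    by_cases h : θ ≤ α
    · exact Or.inl ⟨θ, ⟨hθ0, h⟩, hθ.symm⟩
    · refine Or.inr ⟨2 * Real.pi - θ, ⟨by linarith, by linarith⟩, ?_⟩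
      rw [hθ, circularArc_eq_iff hP0]
      exact ⟨-1, by push_cast; ring⟩
  · rintro z (⟨θ, -, rfl⟩ | ⟨θ, -, rfl⟩) <;> simp [norm_circularArc, hP]

theorem circularArc_inter_subset {P : ℂ} (hP0 : P ≠ 0) {α : ℝ}
    (hα : 0 < α) (hα' : α < 2 * Real.pi) :
    circularArc P 1 '' Icc 0 α ∩ circularArc P (-1) '' Icc 0 (2 * Real.pi - α) ⊆
      {P, circularArc P 1 α} := by
  rintro z ⟨⟨x, hx, rfl⟩, ⟨y, hy, h⟩⟩
  obtain ⟨n, hn⟩ := (circularArc_eq_iff hP0).1 h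
  have hpi := Real.pi_pos
  by_cases h1 : x + y < 2 * Real.pi
  · have hn0 : n = 0 :=
      int_eq_zero_of_mul_two_pi (x := -1 * y - 1 * x) (by linarith) (by linarith)
        (by linarith [hx.1, hy.1])
    rw [hn0] at hn
    push_cast at hn
    have : x = 0 := by linarith [hx.1, hy.1]
    left
    rw [this, circularArc_zero]
  · have : x = α := by linarith [hx.2, hy.2]
    right
    rw [this]
    rfl

/-- A crosscut `e` of a disk, along which and along whose two complementary boundary arcs the
winding of `φ` does not cancel, divides the disk into exactly two components, each of which
contains a zero of `φ`. -/
theorem crosscut_components {r a b : ℝ} (hr : 0 < r) (hab : a < b) {e : ℝ → ℂ}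
    (he : ContinuousOn e (Icc a b)) (hei : InjOn e (Icc a b)) (hea : ‖e a‖ = r) (heb : ‖e b‖ = r)
    (hin : ∀ x ∈ Ioo a b, ‖e x‖ < r) {φ : ℂ → ℂ} (hφ : ContinuousOn φ (closedBall 0 r))
    (hφ0 : ∀ z ∈ sphere (0 : ℂ) r, φ z ≠ 0) {Le : ℝ → ℂ} (hLe : ContinuousOn Le (Icc a b))
    (hLe' : ∀ x ∈ Icc a b, Complex.exp (Le x) = φ (e x))
    (hw : ∀ σ : ℝ, σ = 1 ∨ σ = -1 → ∀ α ∈ Ioo 0 (2 * Real.pi), e a = circularArc (e b) σ α →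
      ∀ Lc : ℝ → ℂ, Continuous Lc → (∀ θ, Complex.exp (Lc θ) = φ (circularArc (e b) σ θ)) →
        Lc α - Lc 0 + (Le b - Le a) ≠ 0) :
    (componentsOf (ball 0 r \ e '' Ioo a b)).ncard = 2 ∧
      ∀ C ∈ componentsOf (ball 0 r \ e '' Ioo a b), ∃ z ∈ C, φ z = 0 := by
  set P := e b with hP
  set E := e '' Icc a b with hE
  have hP0 : P ≠ 0 := norm_pos_iff.1 (heb ▸ hr)
  have hEc : IsClosed E := (isCompact_Icc.image_of_continuousOn he).isClosed
  have hEp : IsPreconnected E := isPreconnected_Icc.image _ he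
  have hla : a ∈ Icc a b := left_mem_Icc.2 hab.le
  have hrb : b ∈ Icc a b := right_mem_Icc.2 hab.le
  have hEne : E.Nonempty := ⟨_, _, hla, rfl⟩
  have hcase : ∀ x ∈ Icc a b, x = a ∨ x = b ∨ x ∈ Ioo a b := by
    intro x hx
    rcases hx.1.eq_or_lt with h | h
    · exact Or.inl h.symm
    · rcases hx.2.eq_or_lt with h' | h'
      · exact Or.inr (Or.inl h')
      · exact Or.inr (Or.inr ⟨h, h'⟩)
  have hEb : E ⊆ closedBall 0 r := by
    rintro _ ⟨x, hx, rfl⟩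
    rw [mem_closedBall_zero_iff]
    rcases hcase x hx with rfl | rfl | h
    · exact hea.le
    · exact heb.le
    · exact (hin x h).le
  have hS : ball (0 : ℂ) r \ e '' Ioo a b = ball (0 : ℂ) r \ E := by
    ext z
    refine ⟨fun hz => ⟨hz.1, ?_⟩, fun hz => ⟨hz.1, fun h => hz.2 (image_mono Ioo_subset_Icc_self h)⟩⟩
    rintro ⟨x, hx, rfl⟩
    have hz1 := mem_ball_zero_iff.1 hz.1
    rcases hcase x hx with rfl | rfl | h
    · exact hz1.ne hea
    · exact hz1.ne heb
    · exact hz.2 ⟨x, h, rfl⟩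
  rw [hS]
  set S := ball (0 : ℂ) r \ E with hSdef
  have hSo : IsOpen S := isOpen_ball.sdiff hEc
  obtain ⟨α, hα0, hα1, hα⟩ : ∃ α : ℝ, 0 < α ∧ α < 2 * Real.pi ∧ e a = circularArc P 1 α := by
    have hmem : e a ∈ sphere (0 : ℂ) r := by simpa using hea
    have hpi := Real.pi_pos
    rw [sphere_eq_union_circularArc hr heb hpi (by linarith)] at hmem
    have hne : e a ≠ P := fun h => hab.ne (hei hla hrb h)
    rcases hmem with ⟨θ, hθ, h⟩ | ⟨θ, hθ, h⟩
    · have h0 : θ ≠ 0 := by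
        rintro rfl
        exact hne (h.symm.trans (circularArc_zero _ _))
      exact ⟨θ, lt_of_le_of_ne hθ.1 h0.symm, by linarith [hθ.2], h.symm⟩
    · have h0 : θ ≠ 0 := by
        rintro rfl
        exact hne (h.symm.trans (circularArc_zero _ _))
      refine ⟨2 * Real.pi - θ, by linarith [hθ.2], by linarith [lt_of_le_of_ne hθ.1 h0.symm], ?_⟩
      rw [← h, circularArc_eq_iff hP0]
      exact ⟨-1, by push_cast; ring⟩
  have hα' : e a = circularArc P (-1) (2 * Real.pi - α) := by
    rw [hα, circularArc_eq_iff hP0]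
    exact ⟨1, by push_cast; ring⟩
  have hsph := sphere_eq_union_circularArc hr heb hα0 hα1
  have hint := circularArc_inter_subset hP0 hα0 hα1
  have harcS : ∀ σ θ, circularArc P σ θ ∈ sphere (0 : ℂ) r := fun σ θ => by
    simp [norm_circularArc, heb]
  have hEsph : ∀ x ∈ Icc a b, e x ∈ sphere (0 : ℂ) r → x = a ∨ x = b := by
    intro x hx hxs
    rcases hcase x hx with h | h | h
    · exact Or.inl h
    · exact Or.inr h
    · have h1 := hin x h
      have h2 : ‖e x‖ = r := by simpa using hxs
      linarith
  -- an arc meets the crosscut in its endpoints only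
  have hmeet : ∀ σ : ℝ, σ = 1 ∨ σ = -1 → ∀ α < 2 * Real.pi, 0 < α → e a = circularArc P σ α →
      ∀ x ∈ Icc a b, ∀ y ∈ Icc 0 α, e x = circularArc P σ y → x = a ∧ y = α ∨ x = b ∧ y = 0 := by
    intro σ hσ α hα1 hα0 hα x hx y hy h
    have hinj := injOn_circularArc hP0 hσ hα1
    rcases hEsph x hx (h ▸ harcS σ y) with rfl | rfl
    · exact Or.inl ⟨rfl, hinj hy (right_mem_Icc.2 hα0.le) (h.symm.trans hα)⟩
    · refine Or.inr ⟨rfl, hinj hy (left_mem_Icc.2 hα0.le) ?_⟩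
      rw [circularArc_zero, ← h]
  have hnotE : ∀ σ : ℝ, σ = 1 ∨ σ = -1 → ∀ α < 2 * Real.pi, 0 < α → e a = circularArc P σ α →
      ∀ θ ∈ Ioo 0 α, circularArc P σ θ ∉ E := by
    rintro σ hσ α hα1 hα0 hα θ hθ ⟨x, hx, hxθ⟩
    rcases hmeet σ hσ α hα1 hα0 hα x hx θ (Ioo_subset_Icc_self hθ) hxθ with ⟨-, h⟩ | ⟨-, h⟩
    · exact hθ.2.ne h
    · exact hθ.1.ne' h
  have hβ0 : 0 < 2 * Real.pi - α := by linarith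
  have hβ1 : 2 * Real.pi - α < 2 * Real.pi := by linarith
  have hnE₁ := hnotE 1 (Or.inl rfl) α hα1 hα0 hα
  have hnE₂ := hnotE (-1) (Or.inr rfl) _ hβ1 hβ0 hα'
  obtain ⟨z₁, hz₁, hcl₁, hu₁⟩ := exists_component_touching_arc hr hα0 hEc hEne
    (continuous_circularArc P 1) (harcS 1) hnE₁
  obtain ⟨z₂, hz₂, hcl₂, hu₂⟩ := exists_component_touching_arc hr hβ0 hEc hEne
    (continuous_circularArc P (-1)) (harcS (-1)) hnE₂
  have hmid₁ : α / 2 ∈ Ioo 0 α := ⟨by linarith, by linarith⟩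
  have hmid₂ : (2 * Real.pi - α) / 2 ∈ Ioo 0 (2 * Real.pi - α) := ⟨by linarith, by linarith⟩
  have hends : ({P, circularArc P 1 α} : Set ℂ) ⊆ E := by
    rintro z (rfl | rfl)
    · exact ⟨b, hrb, rfl⟩
    · exact ⟨a, hla, hα⟩
  have hA₁c : IsClosed (circularArc P 1 '' Icc 0 α) :=
    (isCompact_Icc.image (continuous_circularArc P 1)).isClosed
  have hA₂c : IsClosed (circularArc P (-1) '' Icc 0 (2 * Real.pi - α)) :=
    (isCompact_Icc.image (continuous_circularArc P (-1))).isClosed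
  have hjoin : ∀ z, ∀ θ ∈ Ioo 0 α, ∀ θ' ∈ Ioo 0 (2 * Real.pi - α),
      circularArc P 1 θ ∈ closure (connectedComponentIn S z) →
      circularArc P (-1) θ' ∈ closure (connectedComponentIn S z) → False := by
    intro z θ hθ θ' hθ' h1 h2
    exact not_preconnected_joining_arcs hr hEc hEp hEne hEb hA₁c hA₂c hsph (hint.trans hends)
      isPreconnected_connectedComponentIn (connectedComponentIn_subset S z) h1 h2
      ⟨θ, Ioo_subset_Icc_self hθ, rfl⟩ ⟨θ', Ioo_subset_Icc_self hθ', rfl⟩ (hnE₁ θ hθ) (hnE₂ θ' hθ')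
  have hsphE : ∀ w ∈ sphere (0 : ℂ) r, w ∉ E → (∃ θ ∈ Ioo 0 α, circularArc P 1 θ = w) ∨
      ∃ θ ∈ Ioo 0 (2 * Real.pi - α), circularArc P (-1) θ = w := by
    intro w hws hwE
    rw [hsph] at hws
    rcases hws with ⟨θ, hθ, rfl⟩ | ⟨θ, hθ, rfl⟩
    · refine Or.inl ⟨θ, ⟨lt_of_le_of_ne hθ.1 ?_, lt_of_le_of_ne hθ.2 ?_⟩, rfl⟩
      · rintro rfl
        exact hwE ⟨b, hrb, (circularArc_zero _ _).symm⟩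
      · rintro rfl
        exact hwE ⟨a, hla, hα⟩
    · refine Or.inr ⟨θ, ⟨lt_of_le_of_ne hθ.1 ?_, lt_of_le_of_ne hθ.2 ?_⟩, rfl⟩
      · rintro rfl
        exact hwE ⟨b, hrb, (circularArc_zero _ _).symm⟩
      · rintro rfl
        exact hwE ⟨a, hla, hα'⟩
  have hne₁₂ : connectedComponentIn S z₁ ≠ connectedComponentIn S z₂ := by
    intro h
    exact hjoin z₁ _ hmid₁ _ hmid₂ hcl₁ (h ▸ hcl₂)
  -- Every component reaches the circle off `E`, hence one of the two open arcs, and each open arc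
  -- is touched by one component only.
  have hcomp : componentsOf S = {connectedComponentIn S z₁, connectedComponentIn S z₂} := by
    ext C
    constructor
    · rintro ⟨z, hz, rfl⟩
      obtain ⟨w, hwc, hws, hwE⟩ := exists_mem_closure_component_sphere hab.le he hei hz
      rcases hsphE w hws hwE with ⟨θ, hθ, rfl⟩ | ⟨θ, hθ, rfl⟩
      · exact Or.inl (hu₁ z θ hθ hwc)
      · exact Or.inr (hu₂ z θ hθ hwc)
    · rintro (rfl | rfl)
      · exact ⟨z₁, hz₁, rfl⟩
      · exact ⟨z₂, hz₂, rfl⟩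
  have hfr : ∀ z, ∀ w ∈ frontier (connectedComponentIn S z), w ∈ E ∨ w ∈ sphere (0 : ℂ) r := by
    intro z w hw
    have hwS := disjoint_left.1 (frontier_connectedComponentIn_disjoint hSo z) hw
    have hwb : w ∈ closedBall (0 : ℂ) r :=
      closure_minimal ((connectedComponentIn_subset S z).trans
        (sdiff_subset.trans ball_subset_closedBall)) isClosed_closedBall (frontier_subset_closure hw)
    by_contra! hcon
    have hlt := lt_of_le_of_ne (mem_closedBall.1 hwb) (fun h => hcon.2 (mem_sphere.2 h))
    exact hwS ⟨mem_ball.2 hlt, hcon.1⟩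
  -- Argument principle: a zero-free component bounded by the crosscut and one circular arc would
  -- force zero winding along them, against `hw`.
  have hzero : ∀ σ : ℝ, σ = 1 ∨ σ = -1 → ∀ α < 2 * Real.pi, 0 < α → e a = circularArc P σ α →
      ∀ z ∈ S, frontier (connectedComponentIn S z) ⊆ E ∪ circularArc P σ '' Icc 0 α →
      ∃ w ∈ connectedComponentIn S z, φ w = 0 := by
    intro σ hσ α hα1 hα0 hα z hz hf
    by_contra! hcon
    have hsub := connectedComponentIn_subset S z
    have hclb : closure (connectedComponentIn S z) ⊆ closedBall 0 r :=
      closure_minimal (hsub.trans (sdiff_subset.trans ball_subset_closedBall)) isClosed_closedBall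
    have h0 : ∀ w ∈ closure (connectedComponentIn S z), φ w ≠ 0 := by
      intro w hwc
      by_cases hwC : w ∈ connectedComponentIn S z
      · exact hcon w hwC
      · have hwf : w ∈ frontier (connectedComponentIn S z) := by
          rw [hSo.connectedComponentIn.frontier_eq]
          exact ⟨hwc, hwC⟩
        rcases hfr z w hwf with ⟨x, hx, rfl⟩ | h
        · rw [← hLe' x hx]
          exact Complex.exp_ne_zero _
        · exact hφ0 w h
    have hcc := continuous_circularArc P σ
    obtain ⟨Lc, hLc, hLc'⟩ := exists_continuous_log (F := fun θ => φ (circularArc P σ θ))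
      (hφ.comp_continuous hcc fun θ => sphere_subset_closedBall (harcS σ θ))
      (fun θ => hφ0 _ (harcS σ θ))
    refine hw σ hσ α ⟨hα0, hα1⟩ hα Lc hLc hLc' ?_
    refine winding_eq_zero_of_frontier hab.le hα0.le he hei hcc.continuousOn
      (injOn_circularArc hP0 hσ hα1) hα (circularArc_zero P σ).symm
      (hmeet σ hσ α hα1 hα0 hα) hSo.connectedComponentIn
      (isBounded_ball.subset (hsub.trans sdiff_subset)) ⟨z, mem_connectedComponentIn hz⟩ hf ?_
      (hφ.mono hclb) h0 hLe hLc.continuousOn hLe' (fun θ _ => hLc' θ)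
    rw [disjoint_left]
    intro w hw hw'
    have hwS := hsub hw
    rcases hw' with h | ⟨θ, -, rfl⟩
    · exact hwS.2 h
    · exact (mem_ball.1 hwS.1).ne (mem_sphere.1 (harcS σ θ))
  rw [hcomp]
  refine ⟨ncard_pair hne₁₂, ?_⟩
  rintro C (rfl | rfl)
  -- The frontier of this component contains no interior point of the opposite arc, since the
  -- component would then join the two arcs across `E`.
  · refine hzero 1 (Or.inl rfl) α hα1 hα0 hα z₁ hz₁ fun w hw => ?_
    by_cases hwE : w ∈ E
    · exact Or.inl hwE
    rcases hsphE w ((hfr z₁ w hw).resolve_left hwE) hwE with ⟨θ, hθ, rfl⟩ | ⟨θ, hθ, rfl⟩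
    · exact Or.inr ⟨θ, Ioo_subset_Icc_self hθ, rfl⟩
    · exact (hjoin z₁ _ hmid₁ θ hθ hcl₁ (frontier_subset_closure hw)).elim
  · refine hzero (-1) (Or.inr rfl) _ hβ1 hβ0 hα' z₂ hz₂ fun w hw => ?_
    by_cases hwE : w ∈ E
    · exact Or.inl hwE
    rcases hsphE w ((hfr z₂ w hw).resolve_left hwE) hwE with ⟨θ, hθ, rfl⟩ | ⟨θ, hθ, rfl⟩
    · exact (hjoin z₂ θ hθ _ hmid₂ (frontier_subset_closure hw) hcl₂).elim
    · exact Or.inr ⟨θ, Ioo_subset_Icc_self hθ, rfl⟩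

/-! ### Turning of the displacement along an orbit arc -/

theorem norm_log_le_of_norm_sub_one_le {z : ℂ} {ε : ℝ} (hε : ε ≤ 1 / 2) (h : ‖z - 1‖ ≤ ε) :
    ‖Complex.log z‖ ≤ 2 * ε := by
  have h1 := Complex.norm_log_one_add_half_le_self (z := z - 1) (h.trans hε)
  rw [add_sub_cancel] at h1
  linarith [norm_nonneg (z - 1)]

theorem mem_slitPlane_of_norm_sub_one {z : ℂ} (h : ‖z - 1‖ < 1) : z ∈ Complex.slitPlane := by
  simpa using Complex.mem_slitPlane_of_norm_lt_one h

theorem one_sub_re_pos {u : ℂ} (h : ‖u‖ ≤ 1) (h1 : u ≠ 1) : 0 < (1 - u).re := by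
  rw [Complex.sub_re, Complex.one_re, sub_pos]
  have h2 := (Complex.re_le_norm u).trans h
  refine lt_of_le_of_ne h2 fun h3 => h1 ?_
  have h4 : ‖u‖ ^ 2 = u.re ^ 2 + u.im ^ 2 := by rw [Complex.sq_norm, Complex.normSq_apply]; ring
  have h5 : ‖u‖ ^ 2 ≤ 1 := by nlinarith [norm_nonneg u]
  have h6 : u.im = 0 := by nlinarith [sq_nonneg u.im]
  exact Complex.ext (by simpa using h3) (by simpa using h6)

/-- By strict convexity of the disk, chords from `Q` point into the half-plane around `-Q`. The
principal logarithm is therefore a continuous branch on all of them. -/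
theorem chord_div_re_pos {w Q : ℂ} (hQ : Q ≠ 0) (h : ‖w‖ ≤ ‖Q‖) (hne : w ≠ Q) :
    0 < ((w - Q) / (-Q)).re := by
  have h1 : (w - Q) / (-Q) = 1 - w / Q := by field_simp; ring
  rw [h1]
  refine one_sub_re_pos ?_ fun h2 => hne ((div_eq_one_iff_eq hQ).1 h2)
  rw [norm_div]
  exact div_le_one_of_le₀ h (norm_nonneg _)

theorem chord_div_re_pos' {w P : ℂ} (hP : P ≠ 0) (h : ‖w‖ ≤ ‖P‖) (hne : w ≠ P) :
    0 < ((P - w) / P).re := by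
  have := chord_div_re_pos hP h hne
  rwa [show (P - w) / P = (w - P) / (-P) by field_simp; ring]

theorem mem_slitPlane_of_re_pos {z : ℂ} (h : 0 < z.re) : z ∈ Complex.slitPlane := Or.inl h

/-- If a function varies little over every step of length `1`, then so does its argument, provided
that this is true for one step. -/
theorem abs_im_log_step_le {s t : ℝ} {F L : ℝ → ℂ} (hL : ContinuousOn L (Icc s t))
    (hLF : ∀ x ∈ Icc s t, Complex.exp (L x) = F x)
    (hF : ∀ x ∈ Icc s (t - 1), ‖F (x + 1) - F x‖ ≤ 1 / 8 * ‖F (x + 1)‖)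
    {x₀ : ℝ} (hx₀ : x₀ ∈ Icc s (t - 1)) (h₀ : |(L (x₀ + 1) - L x₀).im| < Real.pi)
    {x : ℝ} (hx : x ∈ Icc s (t - 1)) : |(L (x + 1) - L x).im| ≤ 1 / 4 := by
  have hm : ∀ x ∈ Icc s (t - 1), x ∈ Icc s t := fun x hx => ⟨hx.1, by linarith [hx.2]⟩
  have hm1 : ∀ x ∈ Icc s (t - 1), x + 1 ∈ Icc s t := fun x hx =>
    ⟨by linarith [hx.1], by linarith [hx.2]⟩
  have hFc : ContinuousOn F (Icc s t) := (hL.cexp).congr fun x hx => (hLF x hx).symm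
  have hF0 : ∀ x ∈ Icc s t, F x ≠ 0 := fun x hx => hLF x hx ▸ Complex.exp_ne_zero _
  have hnear : ∀ x ∈ Icc s (t - 1), ‖F x / F (x + 1) - 1‖ ≤ 1 / 8 := by
    intro x hx
    have h1 := hF0 _ (hm1 x hx)
    rw [div_sub_one h1, norm_div, norm_sub_rev]
    exact div_le_of_le_mul₀ (norm_nonneg _) (by norm_num) (hF x hx)
  have hlog : ∀ x ∈ Icc s (t - 1), |(Complex.log (F x / F (x + 1))).im| ≤ 1 / 4 := fun x hx =>
    (Complex.abs_im_le_norm _).trans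
      ((norm_log_le_of_norm_sub_one_le (by norm_num) (hnear x hx)).trans (by norm_num))
  have hshift : ContinuousOn (fun x : ℝ => x + 1) (Icc s (t - 1)) := by fun_prop
  have hL1 := hL.comp hshift hm1
  have hF1 := hFc.comp hshift hm1
  have hexp : ∀ x ∈ Icc s (t - 1),
      Complex.exp (L (x + 1) - L x + Complex.log (F x / F (x + 1))) = 1 := by
    intro x hx
    have h1 := hF0 _ (hm1 x hx)
    have h2 := hF0 _ (hm x hx)
    rw [Complex.exp_add, Complex.exp_sub, hLF _ (hm x hx), hLF _ (hm1 x hx),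
      Complex.exp_log (div_ne_zero h2 h1)]
    field_simp
  -- The increment over a unit step, corrected by a small principal logarithm, is a continuous
  -- multiple of `2πi`, hence constant. The bound at `x₀` identifies it as zero.
  have hconst := isPreconnected_Icc.eq_of_exp_eq_one
    (D := fun x => L (x + 1) - L x + Complex.log (F x / F (x + 1)))
    ((hL1.sub (hL.mono hm)).add (((hFc.mono hm).div hF1 fun x hx => hF0 _ (hm1 x hx)).clog
      fun x hx => mem_slitPlane_of_norm_sub_one ((hnear x hx).trans_lt (by norm_num))))
    hexp hx hx₀
  obtain ⟨n, hn⟩ := Complex.exp_eq_one_iff.1 (hexp x₀ hx₀)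
  have hpi := Real.pi_gt_three
  have hn0 : n = 0 := by
    have him := congrArg Complex.im hn
    have h1 := hlog x₀ hx₀
    rw [Complex.add_im] at him
    have h2 : ((n : ℂ) * (2 * Real.pi * Complex.I)).im = n * (2 * Real.pi) := by simp
    rw [h2] at him
    rw [abs_le] at h1
    rw [abs_lt] at h₀
    exact int_eq_zero_of_mul_two_pi him (by linarith) (by linarith)
  rw [hn0] at hn
  simp only [Int.cast_zero, zero_mul] at hn
  have h3 : L (x + 1) - L x = -Complex.log (F x / F (x + 1)) := by
    rw [hn] at hconst
    linear_combination hconst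
  rw [h3, Complex.neg_im, abs_neg]
  exact hlog x hx

/-- The rotation of the chord of a simple arc over a step of length `1`, when the ends of the arc
are extremal points. -/
theorem log_chord_increment {s t : ℝ} (hst : s + 1 ≤ t) {γ : ℝ → ℂ}
    (hγ : ContinuousOn γ (Icc s t)) (hinj : InjOn γ (Icc s t)) (hP : γ t ≠ 0) (hQ : γ s ≠ 0)
    (hreQ : ∀ y ∈ Icc (s + 1) t, 0 < ((γ y - γ s) / (-γ s)).re)
    (hreP : ∀ x ∈ Icc s (t - 1), 0 < ((γ t - γ x) / γ t).re)
    {L : ℝ → ℂ} (hL : ContinuousOn L (Icc (s + 1) t))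
    (hL' : ∀ x ∈ Icc (s + 1) t, Complex.exp (L x) = γ x - γ (x - 1)) :
    L t - L (s + 1) = (Complex.log ((γ t - γ s) / (-γ s)) -
        Complex.log ((γ (s + 1) - γ s) / (-γ s))) +
      (Complex.log ((γ t - γ (t - 1)) / γ t) - Complex.log ((γ t - γ s) / γ t)) := by
  -- The clamps retract the plane onto the triangle `s ≤ x`, `x + 1 ≤ y ≤ t`, where the chord `γ y -
  -- γ x` does not vanish, so its logarithm `M` exists globally. The side `y = x + 1` is then
  -- replaced by the legs `x = s` and `y = t`.
  set cx : ℝ × ℝ → ℝ := fun z => max s (min z.1 (t - 1)) with hcx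
  set cy : ℝ × ℝ → ℝ := fun z => max (cx z + 1) (min z.2 t) with hcy
  have h1 : ∀ z, s ≤ cx z := fun z => le_max_left _ _
  have h2 : ∀ z, cx z ≤ t - 1 := fun z => max_le (by linarith) (min_le_right _ _)
  have h3 : ∀ z, cx z + 1 ≤ cy z := fun z => le_max_left _ _
  have h4 : ∀ z, cy z ≤ t := fun z => max_le (by linarith [h2 z]) (min_le_right _ _)
  have hcxc : Continuous cx := by fun_prop
  have hcyc : Continuous cy := by fun_prop
  have mx : ∀ z, cx z ∈ Icc s t := fun z => ⟨h1 z, by linarith [h3 z, h4 z]⟩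
  have my : ∀ z, cy z ∈ Icc s t := fun z => ⟨by linarith [h3 z, h1 z], h4 z⟩
  obtain ⟨M, hM, hM'⟩ := exists_continuous_log (F := fun z => γ (cy z) - γ (cx z))
    ((hγ.comp_continuous hcyc my).sub (hγ.comp_continuous hcxc mx)) (fun z h => by
      have := hinj (my z) (mx z) (sub_eq_zero.1 h)
      linarith [h3 z])
  have hval : ∀ x y, s ≤ x → x + 1 ≤ y → y ≤ t → Complex.exp (M (x, y)) = γ y - γ x := by
    intro x y hx hxy hy
    have e1 : cx (x, y) = x := by
      simp only [hcx]
      rw [min_eq_left (by linarith), max_eq_right hx]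
    have e2 : cy (x, y) = y := by
      simp only [hcy, e1]
      rw [min_eq_left hy, max_eq_right hxy]
    rw [hM', e1, e2]
  have step1 := isPreconnected_Icc.log_sub_eq (M := fun x => M (x - 1, x)) (c := 1) hL
    (by fun_prop) (fun x hx => by
      rw [hL' x hx, hval (x - 1) x (by linarith [hx.1]) (by linarith) hx.2, one_mul])
    (left_mem_Icc.2 hst) (right_mem_Icc.2 hst)
  have step2 := isPreconnected_Icc.log_sub_eq (L := fun y => M (s, y))
    (M := fun y => Complex.log ((γ y - γ s) / (-γ s))) (c := -γ s) (S := Icc (s + 1) t)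
    (by fun_prop)
    ((((hγ.mono (Icc_subset_Icc_left (by linarith))).sub continuousOn_const).div_const _).clog
      fun y hy => mem_slitPlane_of_re_pos (hreQ y hy))
    (fun y hy => by
      rw [hval s y le_rfl hy.1 hy.2, Complex.exp_log
        (Complex.slitPlane_ne_zero (mem_slitPlane_of_re_pos (hreQ y hy))),
        mul_div_cancel₀ _ (neg_ne_zero.2 hQ)])
    (left_mem_Icc.2 hst) (right_mem_Icc.2 hst)
  have hst' : s ≤ t - 1 := by linarith
  have step3 := isPreconnected_Icc.log_sub_eq (L := fun x => M (x, t))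
    (M := fun x => Complex.log ((γ t - γ x) / γ t)) (c := γ t) (S := Icc s (t - 1))
    (by fun_prop)
    (((continuousOn_const.sub (hγ.mono (Icc_subset_Icc_right (by linarith)))).div_const _).clog
      fun y hy => mem_slitPlane_of_re_pos (hreP y hy))
    (fun y hy => by
      rw [hval y t hy.1 (by linarith [hy.2]) le_rfl, Complex.exp_log
        (Complex.slitPlane_ne_zero (mem_slitPlane_of_re_pos (hreP y hy))),
        mul_div_cancel₀ _ hP])
    (left_mem_Icc.2 hst') (right_mem_Icc.2 hst')
  simp only [add_sub_cancel_right] at step1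
  rw [step1, ← step2, ← step3]
  ring

/-- The quotient of the two numbers is `-exp (-iσα) = exp (iσ(π - α))`. Both have positive real
part, so their arguments differ by less than `π` and no multiple of `2π` intervenes. In
`winding_ne_zero` they compare the chord from `Q` to `P` with the radii at its ends. -/
theorem log_one_sub_exp_sub {σ α : ℝ} (hσ : σ = 1 ∨ σ = -1) (hα : α ∈ Ioo 0 (2 * Real.pi)) :
    Complex.log (1 - Complex.exp (-((σ * α : ℝ) * Complex.I))) -
      Complex.log (1 - Complex.exp ((σ * α : ℝ) * Complex.I)) =
      (σ * (Real.pi - α) : ℝ) * Complex.I := by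
  have hne : Complex.exp ((σ * α : ℝ) * Complex.I) ≠ 1 := by
    intro h
    have := (circularArc_eq_iff (P := 1) one_ne_zero (σ := σ) (σ' := σ) (θ := α) (θ' := 0)).1
      (by simpa [circularArc] using h)
    obtain ⟨n, hn⟩ := this
    have h0 : n = 0 := by
      refine int_eq_zero_of_mul_two_pi (x := σ * α) (by linarith) ?_ ?_ <;>
      rcases hσ with rfl | rfl <;> linarith [hα.1, hα.2]
    rw [h0] at hn
    rcases hσ with rfl | rfl <;> push_cast at hn <;> linarith [hα.1]
  have hne' : Complex.exp (-((σ * α : ℝ) * Complex.I)) ≠ 1 := by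
    rw [Complex.exp_neg]
    simpa using hne
  have hn1 : ‖Complex.exp ((σ * α : ℝ) * Complex.I)‖ = 1 := Complex.norm_exp_ofReal_mul_I _
  have hn2 : ‖Complex.exp (-((σ * α : ℝ) * Complex.I))‖ = 1 := by
    rw [Complex.exp_neg, norm_inv, hn1, inv_one]
  have ha1 := Complex.abs_arg_lt_pi_div_two_iff.2 (Or.inl (one_sub_re_pos hn1.le hne))
  have ha2 := Complex.abs_arg_lt_pi_div_two_iff.2 (Or.inl (one_sub_re_pos hn2.le hne'))
  rw [abs_lt] at ha1 ha2
  have hre : ∀ x : ℝ, ((x : ℂ) * Complex.I).im = x := fun x => by simp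
  refine Complex.exp_inj_of_neg_pi_lt_of_le_pi ?_ ?_ ?_ ?_ ?_
  · rw [Complex.sub_im, Complex.log_im, Complex.log_im]; linarith
  · rw [Complex.sub_im, Complex.log_im, Complex.log_im]; linarith
  · rw [hre]; rcases hσ with rfl | rfl <;> linarith [hα.1, hα.2]
  · rw [hre]; rcases hσ with rfl | rfl <;> linarith [hα.1, hα.2]
  · rw [Complex.exp_sub, Complex.exp_log (sub_ne_zero.2 hne'.symm),
      Complex.exp_log (sub_ne_zero.2 hne.symm)]
    have e1 : (((σ * (Real.pi - α) : ℝ)) : ℂ) * Complex.I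
        = (σ * Real.pi : ℝ) * Complex.I - (σ * α : ℝ) * Complex.I := by push_cast; ring
    have e2 : Complex.exp ((σ * Real.pi : ℝ) * Complex.I) = -1 := by
      rcases hσ with rfl | rfl
      · simp
      · simp [Complex.exp_neg]
    rw [e1, Complex.exp_sub, e2, Complex.exp_neg]
    have h3 := Complex.exp_ne_zero ((σ * α : ℝ) * Complex.I)
    have h4 := sub_ne_zero.2 hne.symm
    rw [div_eq_div_iff h4 h3]
    field_simp
    ring

/-! ### The winding does not cancel -/

/-- The displacement `φ z = z - G z` of a map `G`, whose logarithmic derivative along a circle is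
close to that of `z ^ (q + 1)`, does not have winding number zero along the closed curve
consisting of an arc of the circle from `P` to `Q` and of an orbit arc from `Q` to `P`. The last
summand is the increment of its logarithm along the latter. -/
theorem winding_ne_zero {r : ℝ} (hr : 0 < r) {q : ℕ} (hq : 1 ≤ q) {φ φ' : ℂ → ℂ}
    (hφ' : ∀ z ∈ sphere (0 : ℂ) r, HasDerivAt φ (φ' z) z)
    (hφ0 : ∀ z ∈ sphere (0 : ℂ) r, φ z ≠ 0)
    (hφq : ∀ z ∈ sphere (0 : ℂ) r, ‖z * φ' z / φ z - (q + 1)‖ ≤ 1 / 4)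
    (hφr : ∀ z ∈ sphere (0 : ℂ) r, ‖φ z‖ ≤ r / 8)
    {P Q Y : ℂ} (hP : ‖P‖ = r) (hPin : ‖P - φ P‖ < r) (hQout : r ≤ ‖Q - φ Q‖) (hY : ‖Y‖ < r)
    {σ α : ℝ} (hσ : σ = 1 ∨ σ = -1) (hα : α ∈ Ioo 0 (2 * Real.pi)) (hQ : Q = circularArc P σ α)
    {Lc : ℝ → ℂ} (hLc : Continuous Lc)
    (hLc' : ∀ θ, Complex.exp (Lc θ) = φ (circularArc P σ θ)) {δ : ℂ} (hδ : |δ.im| ≤ 1 / 4) :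
    Lc α - Lc 0 + (δ + ((Complex.log ((P - Q) / (-Q)) - Complex.log ((Y - Q) / (-Q))) +
      (Complex.log (φ P / P) - Complex.log ((P - Q) / P)))) ≠ 0 := by
  intro hzero
  have hσσ : σ * σ = 1 := by rcases hσ with rfl | rfl <;> norm_num
  have hP0 : P ≠ 0 := norm_pos_iff.1 (hP ▸ hr)
  have hQr : ‖Q‖ = r := by rw [hQ, norm_circularArc, hP]
  have hQ0 : Q ≠ 0 := norm_pos_iff.1 (hQr ▸ hr)
  set z : ℝ → ℂ := circularArc P σ with hz
  have hzs : ∀ θ, z θ ∈ sphere (0 : ℂ) r := fun θ => by simp [hz, norm_circularArc, hP]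
  have hzn : ∀ θ, ‖z θ‖ = r := fun θ => by simpa using hzs θ
  have hz0 : ∀ θ, z θ ≠ 0 := fun θ => norm_pos_iff.1 (hzn θ ▸ hr)
  have hzd : ∀ θ, HasDerivAt z (z θ * (σ * Complex.I)) θ := by
    intro θ
    have h1 : HasDerivAt (fun θ : ℝ => (((σ * θ : ℝ) : ℂ)) * Complex.I) (σ * Complex.I) θ := by
      have := (((hasDerivAt_id θ).const_mul σ).ofReal_comp).mul_const Complex.I
      simpa using this
    have h2 := (h1.cexp).const_mul P
    rw [← mul_assoc] at h2
    exact h2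
  have hP' : P ∈ sphere (0 : ℂ) r := by simpa using hP
  -- This constant makes `ℓ 0` the principal logarithm of `φ P / P`.
  set κ : ℂ := Complex.log (φ P / P) - Lc 0 with hκ
  have hLc0 : Complex.exp (Lc 0) = φ P := by rw [hLc' 0, hz, circularArc_zero]
  have hexpκ : Complex.exp κ = P⁻¹ := by
    have h1 := hφ0 P hP'
    rw [hκ, Complex.exp_sub, hLc0, Complex.exp_log (div_ne_zero h1 hP0)]
    field_simp
  set ℓ : ℝ → ℂ := fun θ => Lc θ - (σ * θ : ℝ) * Complex.I + κ with hℓ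
  set w : ℝ → ℂ := fun θ => φ (z θ) / z θ with hw
  have hℓw : ∀ θ, Complex.exp (ℓ θ) = w θ := by
    intro θ
    simp only [hℓ, hw]
    rw [Complex.exp_add, Complex.exp_sub, hexpκ, hLc' θ,
      show z θ = P * Complex.exp ((σ * θ : ℝ) * Complex.I) from rfl]
    have := Complex.exp_ne_zero ((σ * θ : ℝ) * Complex.I)
    field_simp
  -- The derivative of `log w` along the circle is `σ i χ`. Dividing by `z` lowers the exponent `q +
  -- 1` to `q`, so `χ` is close to `q`.
  set χ : ℝ → ℂ := fun θ => z θ * φ' (z θ) / φ (z θ) - 1 with hχ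
  have hχq : ∀ θ, ‖χ θ - q‖ ≤ 1 / 4 := by
    intro θ
    have := hφq (z θ) (hzs θ)
    rwa [show χ θ - q = z θ * φ' (z θ) / φ (z θ) - (q + 1) by simp only [hχ]; ring]
  have hℓd : ∀ θ, HasDerivAt ℓ (σ * Complex.I * χ θ) θ := by
    intro θ
    have h1 : HasDerivAt (fun θ => φ (z θ)) (φ' (z θ) * (z θ * (σ * Complex.I))) θ :=
      (hφ' _ (hzs θ)).comp θ (hzd θ)
    have h2 := HasDerivAt.of_exp_eq hLc.continuousAt (Eventually.of_forall hLc') h1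
    have h3 : HasDerivAt (fun θ : ℝ => (((σ * θ : ℝ) : ℂ)) * Complex.I) (σ * Complex.I) θ := by
      have := (((hasDerivAt_id θ).const_mul σ).ofReal_comp).mul_const Complex.I
      simpa using this
    refine ((h2.sub h3).add_const κ).congr_deriv ?_
    have := hφ0 _ (hzs θ)
    simp only [hχ]
    field_simp
  have hwd : ∀ θ, HasDerivAt w (w θ * (σ * Complex.I * χ θ)) θ := by
    intro θ
    have h1 := (hℓd θ).cexp
    rw [hℓw] at h1
    exact h1.congr_of_eventuallyEq (Eventually.of_forall fun x => (hℓw x).symm)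
  -- the argument of `w` is monotone
  set m : ℝ → ℝ := fun θ => σ * (ℓ θ).im with hm
  have hmd : ∀ θ, HasDerivAt m (χ θ).re θ := by
    intro θ
    have h1 : HasDerivAt (fun θ => (ℓ θ).im) (σ * Complex.I * χ θ).im θ :=
      Complex.imCLM.hasFDerivAt.comp_hasDerivAt θ (hℓd θ)
    refine (h1.const_mul σ).congr_deriv ?_
    have : (σ * Complex.I * χ θ).im = σ * (χ θ).re := by
      simp [Complex.mul_im, Complex.mul_re]
    rw [this, ← mul_assoc, hσσ, one_mul]
  have hq' : (1 : ℝ) ≤ q := by exact_mod_cast hq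
  have hχre : ∀ θ, 0 < (χ θ).re := by
    intro θ
    have h1 := (Complex.abs_re_le_norm (χ θ - q)).trans (hχq θ)
    rw [Complex.sub_re, Complex.natCast_re, abs_le] at h1
    linarith
  have hmono : StrictMono m := strictMono_of_deriv_pos fun θ => by
    rw [(hmd θ).deriv]
    exact hχre θ
  have hpi := Real.pi_gt_three
  have hm0 : -(Real.pi / 2) < m 0 := by
    have h1 : ℓ 0 = Complex.log (φ P / P) := by simp [hℓ, hκ]
    have h2 : 0 < (φ P / P).re := by
      have h3 := chord_div_re_pos' hP0 (w := P - φ P) (hPin.le.trans hP.ge)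
        (fun h => hφ0 P hP' (by linear_combination -h))
      rwa [sub_sub_cancel] at h3
    have h4 := Complex.abs_arg_lt_pi_div_two_iff.2 (Or.inl h2)
    simp only [hm, h1, Complex.log_im]
    rw [abs_lt] at h4
    rcases hσ with rfl | rfl <;> linarith
  -- The assumption of zero winding enters here. It yields `ℓ α = -iσπ - δ + log ((Y - Q) / (-Q))`,
  -- whose last term has argument of modulus less than `π/2`.
  have hmα : m α < -(Real.pi / 2) + 1 / 4 := by
    have hYQ : 0 < ((Y - Q) / (-Q)).re :=
      chord_div_re_pos hQ0 (hY.le.trans hQr.ge) (fun h => by rw [h] at hY; linarith)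
    have h4 := Complex.abs_arg_lt_pi_div_two_iff.2 (Or.inl hYQ)
    have hQe : Q = P * Complex.exp ((σ * α : ℝ) * Complex.I) := hQ
    have he := Complex.exp_ne_zero ((σ * α : ℝ) * Complex.I)
    have e1 : (P - Q) / (-Q) = 1 - Complex.exp (-((σ * α : ℝ) * Complex.I)) := by
      rw [hQe, Complex.exp_neg]
      field_simp
      ring
    have e2 : (P - Q) / P = 1 - Complex.exp ((σ * α : ℝ) * Complex.I) := by
      rw [hQe]
      field_simp
    have e3 := log_one_sub_exp_sub hσ hα
    rw [← e1, ← e2] at e3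
    have e4 : ℓ α = -((σ * Real.pi : ℝ) * Complex.I) - δ + Complex.log ((Y - Q) / (-Q)) := by
      simp only [hℓ, hκ]
      push_cast at e3 ⊢
      linear_combination hzero - e3
    have e5 : (ℓ α).im = -(σ * Real.pi) - δ.im + ((Y - Q) / (-Q)).arg := by
      rw [e4]
      simp [Complex.log_im]
    simp only [hm, e5]
    rw [abs_lt] at h4
    rw [abs_le] at hδ
    rcases hσ with rfl | rfl <;> linarith
  -- hence the modulus of `1 - w` is decreasing
  set N : ℝ → ℝ := fun θ => ‖1 - w θ‖ ^ 2 with hN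
  have hNd : ∀ θ, HasDerivAt N
      (-2 * ((starRingEnd ℂ) (1 - w θ) * (w θ * (σ * Complex.I * χ θ))).re) θ := by
    intro θ
    have h1 := ((hwd θ).const_sub 1).norm_sq
    refine h1.congr_deriv ?_
    rw [Complex.inner, neg_mul, Complex.neg_re, mul_comm (starRingEnd ℂ _)]
    ring
  have hneg : ∀ θ ∈ interior (Icc 0 α), deriv N θ < 0 := by
    intro θ hθ
    rw [interior_Icc] at hθ
    rw [(hNd θ).deriv]
    have hl := hm0.trans (hmono hθ.1)
    have hu := (hmono hθ.2).trans hmα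
    have hwn : ‖w θ‖ ≤ 1 / 8 := by
      simp only [hw]
      rw [norm_div, hzn, div_le_iff₀ hr]
      linarith [hφr (z θ) (hzs θ)]
    have hwpos : 0 < ‖w θ‖ := norm_pos_iff.2 (hℓw θ ▸ Complex.exp_ne_zero _)
    -- The derivative of `N` is `-2 Re (ξ η)`, with `η` introduced below. As `m θ` is within `1/4`
    -- of `-π/2`, `ξ` is nearly a positive real number, while `η` is within `q / 2` of `q`.
    set ξ : ℂ := w θ * (σ * Complex.I) with hξ
    have hξn : ‖ξ‖ = ‖w θ‖ := by
      rcases hσ with h | h <;> simp [hξ, h]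
    have hξre : ‖w θ‖ / 2 < ξ.re := by
      have e1 : w θ = ‖w θ‖ * Complex.exp ((ℓ θ).im * Complex.I) := by
        rw [← hℓw, Complex.norm_exp, Complex.ofReal_exp, ← Complex.exp_add, Complex.re_add_im]
      have e2 : (ℓ θ).im = σ * m θ := by simp only [hm]; rw [← mul_assoc, hσσ, one_mul]
      have e3 : (w θ).im = ‖w θ‖ * Real.sin (σ * m θ) := by
        conv_lhs => rw [e1]
        rw [Complex.im_ofReal_mul, Complex.exp_ofReal_mul_I_im, e2]
      have e4 : ξ.re = -(‖w θ‖ * Real.sin (m θ)) := by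
        have : ξ.re = -(σ * (w θ).im) := by
          simp [hξ, Complex.mul_re]
          ring
        rw [this, e3]
        rcases hσ with h | h <;> simp [h]
      have e5 : 1 / 2 < -Real.sin (m θ) := by
        have h1 := Real.one_sub_sq_div_two_le_cos (x := m θ + Real.pi / 2)
        rw [Real.cos_add_pi_div_two] at h1
        have h2 : (m θ + Real.pi / 2) ^ 2 ≤ 1 / 16 := by
          have h3 : 0 < m θ + Real.pi / 2 := by linarith
          have h4 : m θ + Real.pi / 2 < 1 / 4 := by linarith
          nlinarith
        linarith
      rw [e4]
      nlinarith
    set η : ℂ := χ θ * (starRingEnd ℂ) (1 - w θ) with hη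
    have hηq : ‖η - q‖ ≤ q / 2 := by
      have h1 : η - q = (χ θ - q) - χ θ * (starRingEnd ℂ) (w θ) := by
        simp only [hη, map_sub, map_one]; ring
      have h2 : ‖χ θ‖ ≤ q + 1 / 4 := by
        have := norm_add_le (χ θ - q) (q : ℂ)
        rw [sub_add_cancel, Complex.norm_natCast] at this
        linarith [hχq θ]
      have h3 : ‖χ θ * (starRingEnd ℂ) (w θ)‖ ≤ (q + 1 / 4) * (1 / 8) := by
        rw [norm_mul, RCLike.norm_conj]
        gcongr
      rw [h1]
      refine (norm_sub_le _ _).trans ?_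
      linarith [hχq θ]
    have hprod : (starRingEnd ℂ) (1 - w θ) * (w θ * (σ * Complex.I * χ θ))
        = q * ξ + ξ * (η - q) := by
      simp only [hη, hξ]; ring
    rw [hprod, Complex.add_re]
    have h5 : ((q : ℂ) * ξ).re = q * ξ.re := by simp
    have h6 : |(ξ * (η - q)).re| ≤ ‖w θ‖ * (q / 2) := by
      refine (Complex.abs_re_le_norm _).trans ?_
      rw [norm_mul, hξn]
      gcongr
    rw [abs_le] at h6
    rw [h5]
    have h7 : (q : ℝ) * (‖w θ‖ / 2) < q * ξ.re := by gcongr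
    linarith
  have hanti : StrictAntiOn N (Icc 0 α) := strictAntiOn_of_deriv_neg (convex_Icc 0 α)
    (fun θ _ => (hNd θ).continuousAt.continuousWithinAt) hneg
  have hlt := hanti (left_mem_Icc.2 hα.1.le) (right_mem_Icc.2 hα.1.le) hα.1
  have hval : ∀ θ, ‖1 - w θ‖ = ‖z θ - φ (z θ)‖ / r := by
    intro θ
    rw [← hzn θ, ← norm_div, sub_div, div_self (hz0 θ)]
  have hN0 : ‖1 - w 0‖ < 1 := by
    rw [hval, hz, circularArc_zero, div_lt_one hr]
    exact hPin
  have hNα : 1 ≤ ‖1 - w α‖ := by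
    rw [hval, ← hQ, le_div_iff₀ hr, one_mul]
    exact hQout
  simp only [hN] at hlt
  nlinarith [norm_nonneg (1 - w 0)]

/-- An orbit arc `γ` of the inverse of `G = id - φ` that traverses a disk and does not turn around
over steps of length `1` divides this disk into two components, each of which contains a zero of
the displacement `φ`. -/
theorem orbit_arc_separates {r : ℝ} (hr : 0 < r) {q : ℕ} (hq : 1 ≤ q) {φ φ' : ℂ → ℂ}
    (hφ : ∀ x ∈ closedBall (0 : ℂ) r, ∀ y ∈ closedBall (0 : ℂ) r, ‖φ x - φ y‖ ≤ 1 / 8 * ‖x - y‖)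
    (hφ' : ∀ z ∈ sphere (0 : ℂ) r, HasDerivAt φ (φ' z) z)
    (hφ0 : ∀ z ∈ sphere (0 : ℂ) r, φ z ≠ 0)
    (hφq : ∀ z ∈ sphere (0 : ℂ) r, ‖z * φ' z / φ z - (q + 1)‖ ≤ 1 / 4)
    (hφr : ∀ z ∈ sphere (0 : ℂ) r, ‖φ z‖ ≤ r / 8)
    {s t : ℝ} (hst : s + 2 ≤ t) {γ : ℝ → ℂ} (hγ : ContinuousOn γ (Icc s t))
    (hinj : InjOn γ (Icc s t)) (hs : ‖γ s‖ = r) (ht : ‖γ t‖ = r)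
    (hin : ∀ x ∈ Ioo s t, ‖γ x‖ < r) (horb : ∀ x ∈ Icc (s + 1) t, φ (γ x) = γ x - γ (x - 1))
    (hout : r ≤ ‖γ s - φ (γ s)‖) {x₀ : ℝ} (hx₀ : x₀ ∈ Icc s (t - 1)) {L₀ : ℝ → ℂ}
    (hL₀ : ContinuousOn L₀ (Icc x₀ (x₀ + 1)))
    (hL₀' : ∀ x ∈ Icc x₀ (x₀ + 1), Complex.exp (L₀ x) = φ (γ x))
    (hturn : |(L₀ (x₀ + 1) - L₀ x₀).im| < Real.pi) :
    (componentsOf (ball 0 r \ γ '' Ioo s t)).ncard = 2 ∧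
      ∀ C ∈ componentsOf (ball 0 r \ γ '' Ioo s t), ∃ z ∈ C, φ z = 0 := by
  have hls : s ∈ Icc s t := ⟨le_rfl, by linarith⟩
  have hrt : t ∈ Icc s t := ⟨by linarith, le_rfl⟩
  have hball : ∀ x ∈ Icc s t, γ x ∈ closedBall (0 : ℂ) r := by
    intro x hx
    rw [mem_closedBall_zero_iff]
    rcases hx.1.eq_or_lt with rfl | h
    · exact hs.le
    · rcases hx.2.eq_or_lt with rfl | h'
      · exact ht.le
      · exact (hin x ⟨h, h'⟩).le
  have hφc : ContinuousOn φ (closedBall 0 r) := by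
    have : LipschitzOnWith (1 / 8) φ (closedBall 0 r) := by
      refine LipschitzOnWith.of_dist_le_mul fun x hx y hy => ?_
      rw [dist_eq_norm, dist_eq_norm]
      simpa using hφ x hx y hy
    exact this.continuousOn
  -- The displacement at `γ (x + 1)` is the chord `γ (x + 1) - γ x` itself, so the Lipschitz bound
  -- on `φ` becomes a relative one.
  have hstep : ∀ x ∈ Icc s (t - 1),
      ‖φ (γ (x + 1)) - φ (γ x)‖ ≤ 1 / 8 * ‖φ (γ (x + 1))‖ := by
    intro x hx
    have h1 : x + 1 ∈ Icc (s + 1) t := ⟨by linarith [hx.1], by linarith [hx.2]⟩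
    have h2 := hφ _ (hball (x + 1) ⟨by linarith [hx.1], h1.2⟩) _ (hball x ⟨hx.1, by linarith [hx.2]⟩)
    rwa [horb (x + 1) h1, add_sub_cancel_right] at *
  have hne1 : ∀ x ∈ Icc (s + 1) t, φ (γ x) ≠ 0 := by
    intro x hx h
    rw [horb x hx, sub_eq_zero] at h
    have := hinj ⟨by linarith [hx.1], hx.2⟩ ⟨by linarith [hx.1], by linarith [hx.2]⟩ h
    linarith
  have hne : ∀ x ∈ Icc s t, φ (γ x) ≠ 0 := by
    intro x hx
    by_cases h : s + 1 ≤ x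
    · exact hne1 x ⟨h, hx.2⟩
    -- Before time `s + 1` the chord formula is not available; a zero of the displacement would
    -- contradict the step estimate.
    · intro h0
      have h1 := hstep x ⟨hx.1, by linarith⟩
      have h2 := norm_pos_iff.2 (hne1 (x + 1) ⟨by linarith [hx.1], by linarith⟩)
      rw [h0, sub_zero] at h1
      linarith
  obtain ⟨L, hL, hL'⟩ := exists_continuousOn_log_Icc (by linarith : s ≤ t)
    (hφc.comp hγ hball) hne
  have hsub₀ : Icc x₀ (x₀ + 1) ⊆ Icc s t := Icc_subset_Icc hx₀.1 (by linarith [hx₀.2])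
  have h01 : x₀ ≤ x₀ + 1 := by linarith
  have hturn' : |(L (x₀ + 1) - L x₀).im| < Real.pi := by
    rwa [isPreconnected_Icc.log_sub_eq (c := 1) hL.continuousOn hL₀ (fun x hx => by
      rw [one_mul, hL₀' x hx, hL' x (hsub₀ hx)]; rfl) (left_mem_Icc.2 h01) (right_mem_Icc.2 h01)]
  have hδ := abs_im_log_step_le hL.continuousOn (F := fun x => φ (γ x)) hL' hstep hx₀ hturn'
    (left_mem_Icc.2 (by linarith : s ≤ t - 1))
  have hP0 : γ t ≠ 0 := norm_pos_iff.1 (ht ▸ hr)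
  have hQ0 : γ s ≠ 0 := norm_pos_iff.1 (hs ▸ hr)
  have hchord := log_chord_increment (by linarith) hγ hinj hP0 hQ0
    (fun y hy => chord_div_re_pos hQ0
      (hs.symm ▸ mem_closedBall_zero_iff.1 (hball y ⟨by linarith [hy.1], hy.2⟩)) fun h => by
        have := hinj ⟨by linarith [hy.1], hy.2⟩ hls h
        linarith [hy.1])
    (fun x hx => chord_div_re_pos' hP0
      (ht.symm ▸ mem_closedBall_zero_iff.1 (hball x ⟨hx.1, by linarith [hx.2]⟩)) fun h => by
        have := hinj ⟨hx.1, by linarith [hx.2]⟩ hrt h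
        linarith [hx.2])
    hL.continuousOn (fun x hx => (hL' x ⟨by linarith [hx.1], hx.2⟩).trans (horb x hx))
  have hPφ := horb t ⟨by linarith, le_rfl⟩
  rw [← hPφ] at hchord
  refine crosscut_components hr (by linarith) hγ hinj hs ht hin hφc hφ0 hL.continuousOn hL' ?_
  intro σ hσ α hα hQ Lc hLc hLc'
  have key := winding_ne_zero hr hq hφ' hφ0 hφq hφr (P := γ t) (Q := γ s) (Y := γ (s + 1)) ht
    (by rw [hPφ, sub_sub_cancel]; exact hin _ ⟨by linarith, by linarith⟩) hout
    (hin _ ⟨by linarith, by linarith⟩) hσ hα hQ hLc hLc' hδ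
  rw [← hchord] at key
  convert key using 2
  ring

/-! ### Turning along the limit arc, and its persistence -/

theorem abs_im_log_sub_log_le {z w : ℂ} {ε : ℝ} (hε : ε ≤ 1 / 2) (hz : ‖z - 1‖ ≤ ε)
    (hw : ‖w - 1‖ ≤ ε) : |(Complex.log z - Complex.log w).im| ≤ 4 * ε := by
  refine (Complex.abs_im_le_norm _).trans ((norm_sub_le _ _).trans ?_)
  linarith [norm_log_le_of_norm_sub_one_le hε hz, norm_log_le_of_norm_sub_one_le hε hw]

/-- Along a backward orbit arc that converges to the fixed point `0` of multiplicity `q + 1` of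
`f`, the displacement does not turn around over steps of length `1`. -/
theorem exists_log_displacement_of_tendsto_zero {f u : ℂ → ℂ} {a : ℂ} {q : ℕ} (hq : 1 ≤ q) {ρ : ℝ}
    (hρ : 0 < ρ)
    (hf : ∀ x ∈ ball (0 : ℂ) ρ, ∀ y ∈ ball (0 : ℂ) ρ,
      ‖(f x - f y) - (x - y)‖ ≤ 1 / 48 * ‖x - y‖) (hf0 : f 0 = 0)
    (hfu : ∀ z ∈ ball (0 : ℂ) ρ, f z - z = z ^ (q + 1) * u z) (hu : ContinuousOn u (ball 0 ρ))
    (ha : a ≠ 0) (hua : ∀ z ∈ ball (0 : ℂ) ρ, ‖u z / a - 1‖ ≤ 1 / 48)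
    {γ : ℝ → ℂ} {T : ℝ} (hγ : ContinuousOn γ (Iic T)) (hinj : InjOn γ (Iic T))
    (hγρ : ∀ t ≤ T, γ t ∈ ball (0 : ℂ) ρ) (horb : ∀ t ≤ T - 1, f (γ t) = γ (t + 1))
    (hlim : Tendsto γ atBot (𝓝 0)) {t₀ : ℝ} (ht₀ : t₀ + 2 ≤ T) :
    ∃ L : ℝ → ℂ, Continuous L ∧
      (∀ t ∈ Icc t₀ (t₀ + 1), Complex.exp (L t) = γ (t + 1) - γ t) ∧
      |(L (t₀ + 1) - L t₀).im| ≤ 1 := by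
  have hinj' : ∀ x ≤ T, ∀ y ≤ T, γ x = γ y → x = y := fun x hx y hy h => hinj hx hy h
  have hγ0 : ∀ t ≤ T - 1, γ t ≠ 0 := by
    intro t ht h
    have h1 := horb t ht
    rw [h, hf0, ← h] at h1
    have := hinj' _ (by linarith) _ (by linarith) h1
    linarith
  have h01 : t₀ ≤ t₀ + 1 := by linarith
  have hl : t₀ ∈ Icc t₀ (t₀ + 1) := left_mem_Icc.2 h01
  have hr : t₀ + 1 ∈ Icc t₀ (t₀ + 1) := right_mem_Icc.2 h01
  set ct : ℝ × ℝ → ℝ := fun z => max t₀ (min z.1 (t₀ + 1)) with hct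
  set ch : ℝ × ℝ → ℝ := fun z => max 1 z.2 with hch
  have hctc : Continuous ct := by fun_prop
  have hchc : Continuous ch := by fun_prop
  have ct1 : ∀ z, ct z ≤ t₀ + 1 := fun z => max_le h01 (min_le_right _ _)
  have ch1 : ∀ z, 1 ≤ ch z := fun z => le_max_left _ _
  have hm1 : ∀ z, ct z + 1 ∈ Iic T := fun z => by
    have := ct1 z
    simp only [mem_Iic]; linarith
  have hm2 : ∀ z, ct z + 1 - ch z ∈ Iic T := fun z => by
    have := ct1 z
    have := ch1 z
    simp only [mem_Iic]; linarith
  -- `M (t, h)` is a logarithm of the chord of time length `h` ending at `γ (t + 1)`. The clamps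
  -- make it continuous on the whole plane, so that `h` can be varied from `1` to a large value.
  obtain ⟨M, hM, hM'⟩ := exists_continuous_log (F := fun z => γ (ct z + 1) - γ (ct z + 1 - ch z))
    ((hγ.comp_continuous (by fun_prop) hm1).sub (hγ.comp_continuous (by fun_prop) hm2))
    (fun z h => by
      have := hinj (hm1 z) (hm2 z) (sub_eq_zero.1 h)
      linarith [ch1 z])
  have hval : ∀ t ∈ Icc t₀ (t₀ + 1), ∀ h : ℝ, 1 ≤ h →
      Complex.exp (M (t, h)) = γ (t + 1) - γ (t + 1 - h) := by
    intro t ht h hh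
    have e1 : ct (t, h) = t := by
      simp only [hct]
      rw [min_eq_left ht.2, max_eq_right ht.1]
    have e2 : ch (t, h) = h := max_eq_right hh
    rw [hM', e1, e2]
  -- the rotation of the chord does not depend much on its length
  have hind : ∀ H : ℝ, 1 ≤ H →
      |((M (t₀ + 1, H) - M (t₀, H)) - (M (t₀ + 1, 1) - M (t₀, 1))).im| ≤ 1 / 12 := by
    intro H hH
    have hne : ∀ t ∈ Icc t₀ (t₀ + 1), ∀ h : ℝ, 1 ≤ h → γ (t + 1) - γ (t + 1 - h) ≠ 0 :=
      fun t ht h hh => hval t ht h hh ▸ Complex.exp_ne_zero _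
    set R : ℝ → ℂ := fun h => (γ (t₀ + 1 + 1) - γ (t₀ + 1 + 1 - h)) / (γ (t₀ + 1) - γ (t₀ + 1 - h))
      with hR
    have hnear : ∀ h : ℝ, 1 ≤ h → ‖R h - 1‖ ≤ 1 / 48 := by
      intro h hh
      have h1 := hne t₀ hl h hh
      have h2 := hf _ (hγρ (t₀ + 1) (by linarith)) _ (hγρ (t₀ + 1 - h) (by linarith))
      rw [horb _ (by linarith), horb _ (by linarith),
        show t₀ + 1 - h + 1 = t₀ + 1 + 1 - h by ring] at h2
      simp only [hR]
      rw [div_sub_one h1, norm_div]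
      exact div_le_of_le_mul₀ (norm_nonneg _) (by norm_num) h2
    have hRc : ContinuousOn R (Ici 1) := by
      have hc1 : ContinuousOn (fun h : ℝ => γ (t₀ + 1 + 1 - h)) (Ici 1) :=
        hγ.comp (by fun_prop) fun h hh => by
          have : (1 : ℝ) ≤ h := hh
          simp only [mem_Iic]; linarith
      have hc2 : ContinuousOn (fun h : ℝ => γ (t₀ + 1 - h)) (Ici 1) :=
        hγ.comp (by fun_prop) fun h hh => by
          have : (1 : ℝ) ≤ h := hh
          simp only [mem_Iic]; linarith
      exact (continuousOn_const.sub hc1).div (continuousOn_const.sub hc2) fun h hh => hne t₀ hl h hh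
    have hslit : ∀ h ∈ Ici (1 : ℝ), R h ∈ Complex.slitPlane := fun h hh =>
      mem_slitPlane_of_norm_sub_one ((hnear h hh).trans_lt (by norm_num))
    have hconst := isPreconnected_Ici.log_sub_eq (S := Ici (1 : ℝ))
      (L := fun h => M (t₀ + 1, h) - M (t₀, h)) (M := fun h => Complex.log (R h)) (c := 1)
      (by fun_prop) (hRc.clog hslit) (fun h hh => by
        rw [Complex.exp_sub, hval _ hr h hh, hval _ hl h hh, one_mul,
          Complex.exp_log (Complex.slitPlane_ne_zero (hslit h hh))])
      (mem_Ici.2 le_rfl) (mem_Ici.2 hH)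
    rw [hconst]
    refine (abs_im_log_sub_log_le (by norm_num) (hnear H hH) (hnear 1 le_rfl)).trans (by norm_num)
  have hsub : Icc t₀ (t₀ + 1) ⊆ Iic T := fun t ht => by
    have := ht.2
    simp only [mem_Iic]; linarith
  have hγc : ContinuousOn γ (Icc t₀ (t₀ + 1)) := hγ.mono hsub
  have hγc1 : ContinuousOn (fun t => γ (t + 1)) (Icc t₀ (t₀ + 1)) :=
    hγ.comp (by fun_prop) fun t ht => by
      have := ht.2
      simp only [mem_Iic]; linarith
  have hγ0' : ∀ t ∈ Icc t₀ (t₀ + 1), γ t ≠ 0 := fun t ht => hγ0 t (by linarith [ht.2])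
  have horb' : ∀ t ∈ Icc t₀ (t₀ + 1), f (γ t) = γ (t + 1) := fun t ht =>
    horb t (by linarith [ht.2])
  obtain ⟨ℓ, hℓ, hℓ'⟩ := exists_continuousOn_log_Icc h01 hγc hγ0'
  -- chords of length one
  have hone : |((M (t₀ + 1, 1) - M (t₀, 1)) - (q + 1) * (ℓ (t₀ + 1) - ℓ t₀)).im| ≤ 1 / 12 := by
    have hb : ∀ t ∈ Icc t₀ (t₀ + 1), γ t ∈ ball (0 : ℂ) ρ := fun t ht => hγρ t (hsub ht)
    have hslit : ∀ t ∈ Icc t₀ (t₀ + 1), u (γ t) / a ∈ Complex.slitPlane := fun t ht =>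
      mem_slitPlane_of_norm_sub_one ((hua _ (hb t ht)).trans_lt (by norm_num))
    have h1 := isPreconnected_Icc.log_sub_eq (S := Icc t₀ (t₀ + 1)) (L := fun t => M (t, 1))
      (M := fun t => (q + 1 : ℕ) * ℓ t + Complex.log (u (γ t) / a)) (c := a) (by fun_prop)
      ((by fun_prop : Continuous fun t => ((q + 1 : ℕ) : ℂ) * ℓ t).continuousOn.add
        (((hu.comp hγc hb).div_const a).clog hslit))
      (fun t ht => by
        rw [hval t ht 1 le_rfl, Complex.exp_add, Complex.exp_nat_mul, hℓ' t ht,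
          Complex.exp_log (Complex.slitPlane_ne_zero (hslit t ht)), add_sub_cancel_right,
          ← horb' t ht, hfu _ (hb t ht)]
        field_simp) hl hr
    have h2 := abs_im_log_sub_log_le (by norm_num) (hua _ (hb _ hr)) (hua _ (hb _ hl))
    have h3 : (M (t₀ + 1, 1) - M (t₀, 1)) - (q + 1) * (ℓ (t₀ + 1) - ℓ t₀) =
        Complex.log (u (γ (t₀ + 1)) / a) - Complex.log (u (γ t₀) / a) := by
      rw [h1]; push_cast; ring
    rw [h3]
    linarith
  -- long chords
  obtain ⟨H, hH, hlong⟩ : ∃ H : ℝ, 1 ≤ H ∧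
      |((M (t₀ + 1, H) - M (t₀, H)) - (ℓ (t₀ + 1) - ℓ t₀)).im| ≤ 1 / 6 := by
    obtain ⟨t₁, ht₁, hmin⟩ := isCompact_Icc.exists_isMinOn ⟨t₀, hl⟩ hγc.norm
    have hpos : 0 < ‖γ t₁‖ := norm_pos_iff.2 (hγ0' t₁ ht₁)
    have hev : ∀ᶠ x in atBot, ‖γ x‖ < 1 / 48 * ‖γ t₁‖ := by
      have := hlim.norm
      rw [norm_zero] at this
      exact this.eventually (gt_mem_nhds (by positivity))
    obtain ⟨B, hB⟩ := eventually_atBot.1 hev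
    -- For this length the chords start before time `B`, where `γ` is negligible compared with its
    -- minimal modulus on the interval.
    refine ⟨max 1 (t₀ + 2 - B), le_max_left _ _, ?_⟩
    set H := max 1 (t₀ + 2 - B) with hHdef
    have hH1 : 1 ≤ H := le_max_left _ _
    have hHB : t₀ + 2 - B ≤ H := le_max_right _ _
    set κ : ℝ → ℂ := fun t => (γ (t + 1) - γ (t + 1 - H)) / γ t with hκ
    have hnear : ∀ t ∈ Icc t₀ (t₀ + 1), ‖κ t - 1‖ ≤ 1 / 24 := by
      intro t ht
      have h0 := hγ0' t ht
      simp only [hκ]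
      rw [div_sub_one h0, norm_div]
      refine div_le_of_le_mul₀ (norm_nonneg _) (by norm_num) ?_
      have h1 := hf _ (hγρ t (hsub ht)) 0 (mem_ball_self hρ)
      rw [hf0, horb' t ht, sub_zero, sub_zero] at h1
      have h2 := hB (t + 1 - H) (by linarith [ht.2])
      have h3 : ‖γ t₁‖ ≤ ‖γ t‖ := hmin ht
      have h4 : γ (t + 1) - γ (t + 1 - H) - γ t = (γ (t + 1) - γ t) - γ (t + 1 - H) := by ring
      rw [h4]
      refine (norm_sub_le _ _).trans ?_
      linarith
    have hκc : ContinuousOn κ (Icc t₀ (t₀ + 1)) := by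
      refine ContinuousOn.div (hγc1.sub ?_) hγc hγ0'
      exact hγ.comp (by fun_prop) fun t ht => by
        have := ht.2
        simp only [mem_Iic]; linarith
    have hslit : ∀ t ∈ Icc t₀ (t₀ + 1), κ t ∈ Complex.slitPlane := fun t ht =>
      mem_slitPlane_of_norm_sub_one ((hnear t ht).trans_lt (by norm_num))
    have h1 := isPreconnected_Icc.log_sub_eq (S := Icc t₀ (t₀ + 1)) (L := fun t => M (t, H))
      (M := fun t => ℓ t + Complex.log (κ t)) (c := 1) (by fun_prop)
      (hℓ.continuousOn.add (hκc.clog hslit))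
      (fun t ht => by
        rw [hval t ht H hH1, Complex.exp_add, hℓ' t ht,
          Complex.exp_log (Complex.slitPlane_ne_zero (hslit t ht)), one_mul,
          mul_div_cancel₀ _ (hγ0' t ht)]) hl hr
    have h2 := abs_im_log_sub_log_le (by norm_num) (hnear _ hr) (hnear _ hl)
    have h3 : (M (t₀ + 1, H) - M (t₀, H)) - (ℓ (t₀ + 1) - ℓ t₀) =
        Complex.log (κ (t₀ + 1)) - Complex.log (κ t₀) := by
      rw [h1]; ring
    rw [h3]
    linarith
  refine ⟨fun t => M (t, 1), by fun_prop, fun t ht => ?_, ?_⟩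
  · rw [hval t ht 1 le_rfl, add_sub_cancel_right]
  · have h1 := hind H hH
    -- The turning of `γ` is `Δ`; unit chords turn by about `(q + 1) Δ`, long chords by about `Δ`.
    -- Hence `q |Δ| ≤ 1/12 + 1/12 + 1/6 = 1/3`. With `q ≥ 1` this gives `|Δ| ≤ 1/3`, and `|m₁| ≤ 1/3
    -- + 1/3 + 1/12 < 1`.
    set Δ := (ℓ (t₀ + 1) - ℓ t₀).im with hΔ
    set m₁ := (M (t₀ + 1, 1) - M (t₀, 1)).im with hm₁
    set m₂ := (M (t₀ + 1, H) - M (t₀, H)).im with hm₂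
    rw [Complex.sub_im, ← hm₂, ← hm₁, abs_le] at h1
    rw [Complex.sub_im, ← hm₂, ← hΔ, abs_le] at hlong
    have e1 : ((q + 1 : ℂ) * (ℓ (t₀ + 1) - ℓ t₀)).im = (q + 1) * Δ := by
      have : (q + 1 : ℂ) = ((q + 1 : ℝ) : ℂ) := by push_cast; ring
      rw [this, Complex.im_ofReal_mul]
    rw [Complex.sub_im, ← hm₁, e1, abs_le] at hone
    have hq' : (1 : ℝ) ≤ q := by exact_mod_cast hq
    have hΔ1 : q * Δ ≤ 1 / 3 := by linarith
    have hΔ2 : -(1 / 3) ≤ q * Δ := by linarith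
    have hΔ3 : Δ ≤ 1 / 3 := by
      by_contra! h
      nlinarith
    have hΔ4 : -(1 / 3) ≤ Δ := by
      by_contra! h
      nlinarith
    rw [abs_le]
    constructor <;> linarith

/-- Logarithms persist under small perturbations. -/
theorem eventually_exists_log_of_tendstoUniformlyOn {x₀ : ℝ} {F L : ℝ → ℂ} {Fn : ℕ → ℝ → ℂ}
    (hL : Continuous L) (hLF : ∀ x ∈ Icc x₀ (x₀ + 1), Complex.exp (L x) = F x)
    (hturn : |(L (x₀ + 1) - L x₀).im| ≤ 1)
    (hFn : ∀ᶠ n in atTop, ContinuousOn (Fn n) (Icc x₀ (x₀ + 1)))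
    (hlim : TendstoUniformlyOn Fn F atTop (Icc x₀ (x₀ + 1))) :
    ∀ᶠ n in atTop, ∃ Ln : ℝ → ℂ, ContinuousOn Ln (Icc x₀ (x₀ + 1)) ∧
      (∀ x ∈ Icc x₀ (x₀ + 1), Complex.exp (Ln x) = Fn n x) ∧
      |(Ln (x₀ + 1) - Ln x₀).im| < Real.pi := by
  have h01 : x₀ ≤ x₀ + 1 := by linarith
  have hl : x₀ ∈ Icc x₀ (x₀ + 1) := left_mem_Icc.2 h01
  have hr : x₀ + 1 ∈ Icc x₀ (x₀ + 1) := right_mem_Icc.2 h01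
  have hFc : ContinuousOn F (Icc x₀ (x₀ + 1)) :=
    hL.cexp.continuousOn.congr fun x hx => (hLF x hx).symm
  have hF0 : ∀ x ∈ Icc x₀ (x₀ + 1), F x ≠ 0 := fun x hx => hLF x hx ▸ Complex.exp_ne_zero _
  obtain ⟨x₁, hx₁, hmin⟩ := isCompact_Icc.exists_isMinOn ⟨x₀, hl⟩ hFc.norm
  have hpos : 0 < ‖F x₁‖ := norm_pos_iff.2 (hF0 x₁ hx₁)
  filter_upwards [hFn, Metric.tendstoUniformlyOn_iff.1 hlim (1 / 4 * ‖F x₁‖) (by positivity)]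
    with n hn hd
  have hnear : ∀ x ∈ Icc x₀ (x₀ + 1), ‖Fn n x / F x - 1‖ ≤ 1 / 4 := by
    intro x hx
    have h1 := hd x hx
    rw [dist_comm, dist_eq_norm] at h1
    have h2 : ‖F x₁‖ ≤ ‖F x‖ := hmin hx
    rw [div_sub_one (hF0 x hx), norm_div]
    refine div_le_of_le_mul₀ (norm_nonneg _) (by norm_num) ?_
    linarith
  have hslit : ∀ x ∈ Icc x₀ (x₀ + 1), Fn n x / F x ∈ Complex.slitPlane := fun x hx =>
    mem_slitPlane_of_norm_sub_one ((hnear x hx).trans_lt (by norm_num))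
  refine ⟨fun x => L x + Complex.log (Fn n x / F x),
    hL.continuousOn.add ((hn.div hFc hF0).clog hslit), fun x hx => ?_, ?_⟩
  · rw [Complex.exp_add, hLF x hx, Complex.exp_log (Complex.slitPlane_ne_zero (hslit x hx)),
      mul_div_cancel₀ _ (hF0 x hx)]
  · have h2 := abs_im_log_sub_log_le (by norm_num) (hnear _ hr) (hnear _ hl)
    have h3 : (L (x₀ + 1) + Complex.log (Fn n (x₀ + 1) / F (x₀ + 1)) -
        (L x₀ + Complex.log (Fn n x₀ / F x₀))).im = (L (x₀ + 1) - L x₀).im +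
        (Complex.log (Fn n (x₀ + 1) / F (x₀ + 1)) - Complex.log (Fn n x₀ / F x₀)).im := by
      rw [← Complex.add_im]; congr 1; ring
    rw [h3]
    have hpi := Real.pi_gt_three
    exact (abs_add_le _ _).trans_lt (by linarith)

/-! ### Displacements of maps close to the identity -/

theorem norm_sub_sub_le_of_deriv {F : ℂ → ℂ} {ρ η : ℝ} {c : ℂ}
    (hF : ∀ z ∈ ball (0 : ℂ) ρ, DifferentiableAt ℂ F z)
    (hF' : ∀ z ∈ ball (0 : ℂ) ρ, ‖deriv F z - c‖ ≤ η) {x y : ℂ} (hx : x ∈ ball (0 : ℂ) ρ)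
    (hy : y ∈ ball (0 : ℂ) ρ) : ‖(F x - F y) - c * (x - y)‖ ≤ η * ‖x - y‖ := by
  have hd : ∀ z ∈ ball (0 : ℂ) ρ, HasDerivWithinAt (fun z => F z - c * z) (deriv F z - c)
      (ball 0 ρ) z := fun z hz =>
    (((hF z hz).hasDerivAt.sub ((hasDerivAt_id z).const_mul c)).congr_deriv
      (by simp)).hasDerivWithinAt
  have := (convex_ball (0 : ℂ) ρ).norm_image_sub_le_of_norm_hasDerivWithin_le hd hF' hy hx
  rwa [show F x - F y - c * (x - y) = (F x - c * x) - (F y - c * y) by ring]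

theorem surjOn_of_near_id {F : ℂ → ℂ} {ρ : ℝ} (hρ : 0 ≤ ρ) (hF0 : F 0 = 0)
    (hF : ∀ x ∈ closedBall (0 : ℂ) ρ, ∀ y ∈ closedBall (0 : ℂ) ρ,
      ‖(F x - F y) - (x - y)‖ ≤ 1 / 2 * ‖x - y‖) :
    SurjOn F (closedBall 0 ρ) (closedBall 0 (ρ / 2)) := by
  have h1 : ApproximatesLinearOn F (ContinuousLinearEquiv.refl ℂ ℂ : ℂ →L[ℂ] ℂ)
      (closedBall 0 ρ) (1 / 2) := fun x hx y hy => by simpa using hF x hx y hy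
  have h2 := h1.surjOn_closedBall_of_nonlinearRightInverse
    (ContinuousLinearEquiv.refl ℂ ℂ).toNonlinearRightInverse hρ subset_rfl
  rw [hF0] at h2
  have h3 : ((ContinuousLinearEquiv.refl ℂ ℂ).toNonlinearRightInverse.nnnorm : ℝ) = 1 := by
    change ‖((ContinuousLinearEquiv.refl ℂ ℂ).symm : ℂ →L[ℂ] ℂ)‖ = 1
    simp
  have h4 : ((1 : ℝ)⁻¹ - ((1 / 2 : NNReal) : ℝ)) * ρ = ρ / 2 := by
    push_cast
    ring
  rwa [h3, h4] at h2

/-- The displacement `φ z = z - F⁻¹ z` of the inverse of a map `F` that is close to the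
identity. -/
theorem exists_inverse_displacement {F : ℂ → ℂ} {ρ r : ℝ} {q : ℕ} (hr : 0 < r) (hrρ : 4 * r ≤ ρ)
    (hF : ∀ z ∈ ball (0 : ℂ) ρ, DifferentiableAt ℂ F z) (hF0 : F 0 = 0)
    (hF' : ∀ z ∈ ball (0 : ℂ) ρ, ‖deriv F z - 1‖ ≤ 1 / (48 * (q + 2)))
    (hv : ∀ y, r / 2 ≤ ‖y‖ → ‖y‖ ≤ 2 * r → F y ≠ y ∧
      ‖y * (deriv F y - 1) / (F y - y) - (q + 1)‖ ≤ 1 / 16) :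
    ∃ φ φ' : ℂ → ℂ,
      (∀ x ∈ closedBall (0 : ℂ) r, ∀ y ∈ closedBall (0 : ℂ) r,
        ‖φ x - φ y‖ ≤ 1 / 8 * ‖x - y‖) ∧
      (∀ z ∈ sphere (0 : ℂ) r, HasDerivAt φ (φ' z) z) ∧
      (∀ z ∈ sphere (0 : ℂ) r, φ z ≠ 0) ∧
      (∀ z ∈ sphere (0 : ℂ) r, ‖z * φ' z / φ z - (q + 1)‖ ≤ 1 / 4) ∧
      (∀ z ∈ sphere (0 : ℂ) r, ‖φ z‖ ≤ r / 8) ∧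
      (∀ y ∈ ball (0 : ℂ) ρ, F y ∈ closedBall (0 : ℂ) r → φ (F y) = F y - y) ∧
      ∀ z ∈ closedBall (0 : ℂ) r, φ z = 0 → F z = z := by
  have hq2 : (0 : ℝ) < 48 * (q + 2) := by positivity
  set η : ℝ := 1 / (48 * (q + 2)) with hη
  have hη0 : 0 < η := by positivity
  have hηq : η * (q + 2) = 1 / 48 := by rw [hη]; field_simp
  have hη1 : η ≤ 1 / 48 := by
    have : (0 : ℝ) ≤ q := by positivity
    nlinarith
  have hlip : ∀ x ∈ ball (0 : ℂ) ρ, ∀ y ∈ ball (0 : ℂ) ρ,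
      ‖(F x - F y) - (x - y)‖ ≤ η * ‖x - y‖ := fun x hx y hy => by
    simpa using norm_sub_sub_le_of_deriv hF hF' hx hy
  have hexp : ∀ x ∈ ball (0 : ℂ) ρ, ∀ y ∈ ball (0 : ℂ) ρ, ‖x - y‖ ≤ 2 * ‖F x - F y‖ := by
    intro x hx y hy
    have h1 := hlip x hx y hy
    have h2 : ‖x - y‖ ≤ ‖F x - F y‖ + ‖(F x - F y) - (x - y)‖ := by
      have := norm_sub_le (F x - F y) ((F x - F y) - (x - y))
      rwa [sub_sub_cancel] at this
    nlinarith [norm_nonneg (x - y)]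
  have hinj : InjOn F (ball 0 ρ) := by
    intro x hx y hy h
    have h1 := hexp x hx y hy
    rw [h, sub_self, norm_zero, mul_zero] at h1
    exact sub_eq_zero.1 (norm_le_zero_iff.1 h1)
  have hb3 : closedBall (0 : ℂ) (3 * r) ⊆ ball 0 ρ := closedBall_subset_ball (by linarith)
  -- The disk of radius `3 r` covers that of radius `3 r / 2`, so the inverse is defined on a
  -- neighborhood of the circle of radius `r` and can be differentiated there.
  have hsurj := surjOn_of_near_id (by linarith : 0 ≤ 3 * r) hF0 fun x hx y hy =>
    (hlip x (hb3 hx) y (hb3 hy)).trans (by gcongr; linarith)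
  set G : ℂ → ℂ := Function.invFunOn F (closedBall 0 (3 * r)) with hG
  have hGmem : ∀ z ∈ closedBall (0 : ℂ) (3 * r / 2), G z ∈ ball (0 : ℂ) ρ := fun z hz =>
    hb3 (Function.invFunOn_mem (hsurj hz))
  have hGF : ∀ z ∈ closedBall (0 : ℂ) (3 * r / 2), F (G z) = z := fun z hz =>
    Function.invFunOn_eq (hsurj hz)
  have h0ρ : (0 : ℂ) ∈ ball (0 : ℂ) ρ := mem_ball_self (by linarith)
  have hrr : closedBall (0 : ℂ) r ⊆ closedBall 0 (3 * r / 2) := closedBall_subset_closedBall (by linarith)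
  have hsr : sphere (0 : ℂ) r ⊆ closedBall 0 (3 * r / 2) := sphere_subset_closedBall.trans hrr
  have hGlip : ∀ x ∈ closedBall (0 : ℂ) (3 * r / 2), ∀ y ∈ closedBall (0 : ℂ) (3 * r / 2),
      ‖G x - G y‖ ≤ 2 * ‖x - y‖ := fun x hx y hy => by
    have := hexp _ (hGmem x hx) _ (hGmem y hy)
    rwa [hGF x hx, hGF y hy] at this
  have hφlip : ∀ x ∈ closedBall (0 : ℂ) (3 * r / 2), ∀ y ∈ closedBall (0 : ℂ) (3 * r / 2),
      ‖(x - G x) - (y - G y)‖ ≤ 2 * η * ‖x - y‖ := fun x hx y hy => by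
    have h1 := hlip _ (hGmem x hx) _ (hGmem y hy)
    rw [hGF x hx, hGF y hy] at h1
    rw [show x - G x - (y - G y) = x - y - (G x - G y) by ring]
    have h2 := hGlip x hx y hy
    nlinarith
  have hG0 : G 0 = 0 := by
    have h0 : (0 : ℂ) ∈ closedBall (0 : ℂ) (3 * r / 2) := mem_closedBall_self (by linarith)
    exact hinj (hGmem 0 h0) h0ρ ((hGF 0 h0).trans hF0.symm)
  have hφz : ∀ z ∈ closedBall (0 : ℂ) (3 * r / 2), ‖z - G z‖ ≤ 2 * η * ‖z‖ := fun z hz => by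
    have := hφlip z hz 0 (mem_closedBall_self (by linarith))
    rwa [hG0, sub_zero, sub_zero, sub_zero] at this
  have hF'0 : ∀ y ∈ ball (0 : ℂ) ρ, deriv F y ≠ 0 := by
    intro y hy h
    have h1 := hF' y hy
    rw [h, zero_sub, norm_neg, norm_one] at h1
    linarith
  have hGd : ∀ z ∈ sphere (0 : ℂ) r, HasDerivAt G (deriv F (G z))⁻¹ z := by
    intro z hz
    have hzr : ‖z‖ = r := by simpa using hz
    have hnh : closedBall (0 : ℂ) (3 * r / 2) ∈ 𝓝 z := by
      refine mem_of_superset (isOpen_ball.mem_nhds ?_) ball_subset_closedBall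
      rw [mem_ball_zero_iff]; linarith
    refine HasDerivAt.of_local_left_inverse ?_ (hF _ (hGmem z (hsr hz))).hasDerivAt
      (hF'0 _ (hGmem z (hsr hz))) ?_
    · have : LipschitzOnWith 2 G (closedBall 0 (3 * r / 2)) := by
        refine LipschitzOnWith.of_dist_le_mul fun x hx y hy => ?_
        rw [dist_eq_norm, dist_eq_norm]
        simpa using hGlip x hx y hy
      exact this.continuousOn.continuousAt hnh
    · filter_upwards [hnh] with y hy using hGF y hy
  have hGann : ∀ z ∈ sphere (0 : ℂ) r, r / 2 ≤ ‖G z‖ ∧ ‖G z‖ ≤ 2 * r := by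
    intro z hz
    have hzr : ‖z‖ = r := by simpa using hz
    have h1 := hφz z (hsr hz)
    rw [hzr] at h1
    have h2 : ‖z‖ ≤ ‖z - G z‖ + ‖G z‖ := by simpa using norm_add_le (z - G z) (G z)
    have h3 : ‖G z‖ ≤ ‖z‖ + ‖z - G z‖ := by simpa using norm_sub_le z (z - G z)
    constructor <;> nlinarith
  have hφ0 : ∀ z ∈ sphere (0 : ℂ) r, z - G z ≠ 0 := by
    intro z hz h
    have h1 := hv _ (hGann z hz).1 (hGann z hz).2
    rw [hGF z (hsr hz)] at h1
    exact h1.1 (sub_eq_zero.1 h)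
  refine ⟨fun z => z - G z, fun z => 1 - (deriv F (G z))⁻¹, ?_, ?_, hφ0, ?_, ?_, ?_, ?_⟩
  · intro x hx y hy
    exact (hφlip x (hrr hx) y (hrr hy)).trans (by gcongr; linarith)
  · intro z hz
    exact (hasDerivAt_id z).sub (hGd z hz)
  · intro z hz
    have hzr : ‖z‖ = r := by simpa using hz
    have h1 := (hv _ (hGann z hz).1 (hGann z hz).2).2
    rw [hGF z (hsr hz)] at h1
    set y := G z with hy
    set D := deriv F y with hD
    have hyρ : y ∈ ball (0 : ℂ) ρ := hGmem z (hsr hz)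
    have hD0 : D ≠ 0 := hF'0 y hyρ
    have hD1 : ‖D - 1‖ ≤ η := hF' y hyρ
    have hy0 : y ≠ 0 := norm_pos_iff.1 ((by linarith : 0 < r / 2).trans_le (hGann z hz).1)
    have hzy := hφ0 z hz
    rw [← hy] at hzy
    have hzyn : ‖z - y‖ ≤ η * ‖y‖ := by
      have := hlip y hyρ 0 h0ρ
      rwa [hF0, hGF z (hsr hz), sub_zero, sub_zero] at this
    set κ : ℂ := y * (D - 1) / (z - y) with hκ
    have hDn : 1 / 2 ≤ ‖D‖ := by
      have h2 : ‖(1 : ℂ)‖ ≤ ‖D‖ + ‖D - 1‖ := by simpa using norm_sub_le D (D - 1)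
      rw [norm_one] at h2
      linarith
    have hτ : ‖z / (y * D) - 1‖ ≤ 4 * η := by
      have h2 : z / (y * D) - 1 = ((z - y) / y - (D - 1)) / D := by field_simp; ring
      rw [h2, norm_div, div_le_iff₀ (by linarith)]
      have h3 : ‖(z - y) / y‖ ≤ η := by
        rw [norm_div]
        exact div_le_of_le_mul₀ (norm_nonneg _) hη0.le hzyn
      refine (norm_sub_le _ _).trans ?_
      nlinarith
    -- With `z = F y`, the logarithmic derivative of `φ` at `z` is that of `F - id` at `y`, namely
    -- `κ`, times a factor close to `1`. The total error is at most `1/16 + 4 η (q + 2) = 1/16 +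
    -- 1/12`.
    have hid : z * (1 - D⁻¹) / (z - y) - (q + 1) = (κ - (q + 1)) + κ * (z / (y * D) - 1) := by
      simp only [hκ]; field_simp; ring
    have hκn : ‖κ‖ ≤ q + 2 := by
      have h2 : ‖κ‖ ≤ ‖κ - (q + 1)‖ + ‖(q + 1 : ℂ)‖ := by
        simpa using norm_add_le (κ - (q + 1)) (q + 1 : ℂ)
      have h3 : ‖(q + 1 : ℂ)‖ = q + 1 := by
        rw [show (q + 1 : ℂ) = ((q + 1 : ℕ) : ℂ) by push_cast; ring, Complex.norm_natCast]
        push_cast; ring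
      linarith
    change ‖z * (1 - D⁻¹) / (z - y) - (q + 1)‖ ≤ 1 / 4
    rw [hid]
    refine (norm_add_le _ _).trans ?_
    rw [norm_mul]
    have h4 : ‖κ‖ * ‖z / (y * D) - 1‖ ≤ (q + 2) * (4 * η) := by gcongr
    linarith
  · intro z hz
    have hzr : ‖z‖ = r := by simpa using hz
    have := hφz z (hsr hz)
    rw [hzr] at this
    nlinarith
  · intro y hy hFy
    have h1 := hinj (hGmem _ (hrr hFy)) hy (hGF _ (hrr hFy))
    change F y - G (F y) = F y - y
    rw [h1]
  · intro z hz h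
    have h1 : z = G z := sub_eq_zero.1 h
    have h2 := hGF z (hrr hz)
    rwa [← h1] at h2

/-- Everything follows by continuity from the factorization `f z - z = z ^ (q + 1) * u z` with `a =
u 0 ≠ 0`. In particular the logarithmic derivative of the displacement, times `z`, is `q + 1 + z u'
/ u`. -/
theorem exists_local_data {f : ℂ → ℂ} {q : ℕ} (hq : 1 ≤ q) (hf : AnalyticAt ℂ f 0)
    (hord : analyticOrderAt (fun z => f z - z) 0 = ((q + 1 : ℕ) : ℕ∞)) {r₁ η : ℝ} (hr₁ : 0 < r₁)
    (hη : 0 < η) :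
    ∃ ρ, 0 < ρ ∧ ρ < r₁ ∧ ∃ u : ℂ → ℂ, ∃ a : ℂ, a ≠ 0 ∧ ContinuousOn u (ball 0 ρ) ∧
      (∀ z ∈ ball (0 : ℂ) ρ, f z - z = z ^ (q + 1) * u z) ∧
      (∀ z ∈ ball (0 : ℂ) ρ, ‖u z / a - 1‖ ≤ 1 / 48) ∧
      (∀ z ∈ ball (0 : ℂ) ρ, ‖deriv f z - 1‖ ≤ η) ∧
      ∀ z ∈ ball (0 : ℂ) ρ, z ≠ 0 → f z ≠ z ∧
        ‖z * (deriv f z - 1) / (f z - z) - (q + 1)‖ ≤ 1 / 32 := by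
  obtain ⟨u, hu, hu0, hfu⟩ := (AnalyticAt.analyticOrderAt_eq_natCast (hf.sub analyticAt_id)).1 hord
  have hfu' : ∀ᶠ z in 𝓝 (0 : ℂ), f z - z = z ^ (q + 1) * u z := by
    filter_upwards [hfu] with z hz
    simpa using hz
  have hderiv : ∀ᶠ z in 𝓝 (0 : ℂ),
      deriv f z = 1 + ((q + 1) * z ^ q * u z + z ^ (q + 1) * deriv u z) := by
    filter_upwards [hfu'.eventually_nhds, hu.eventually_analyticAt] with z hz hzu
    have h1 : f =ᶠ[𝓝 z] fun w => w + w ^ (q + 1) * u w := by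
      filter_upwards [hz] with w hw
      rw [← hw]; ring
    have h2 := (hasDerivAt_id z).add ((hasDerivAt_pow (q + 1) z).mul hzu.differentiableAt.hasDerivAt)
    rw [h1.deriv_eq]
    refine (HasDerivAt.deriv h2).trans ?_
    push_cast
    simp
  have hd0 : deriv f 0 = 1 := by
    have hq0 : q ≠ 0 := by omega
    rw [hderiv.self_of_nhds]
    simp [hq0]
  have e3 : ∀ᶠ z in 𝓝 (0 : ℂ), ‖u z / u 0 - 1‖ < 1 / 48 := by
    have h1 : ContinuousAt (fun z => ‖u z / u 0 - 1‖) 0 :=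
      ((hu.continuousAt.div_const _).sub continuousAt_const).norm
    refine h1.eventually_lt_const ?_
    simp [div_self hu0]
  have e4 : ∀ᶠ z in 𝓝 (0 : ℂ), ‖deriv f z - 1‖ < η := by
    have h1 : ContinuousAt (fun z => ‖deriv f z - 1‖) 0 :=
      (hf.deriv.continuousAt.sub continuousAt_const).norm
    refine h1.eventually_lt_const ?_
    simpa [hd0] using hη
  have e5 : ∀ᶠ z in 𝓝 (0 : ℂ), ‖z * deriv u z / u z‖ < 1 / 32 := by
    have h1 : ContinuousAt (fun z => ‖z * deriv u z / u z‖) 0 :=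
      ((continuousAt_id.mul hu.deriv.continuousAt).div hu.continuousAt hu0).norm
    refine h1.eventually_lt_const ?_
    simp
  have e6 : ∀ᶠ z in 𝓝 (0 : ℂ), u z ≠ 0 := hu.continuousAt.eventually_ne hu0
  obtain ⟨ε, hε, hall⟩ := Metric.eventually_nhds_iff_ball.1
    ((hfu'.and (hderiv.and (hu.eventually_analyticAt.and e3))).and (e4.and (e5.and e6)))
  have hlt : min ε (r₁ / 2) < r₁ := (min_le_right _ _).trans_lt (by linarith)
  have hsub : ∀ z ∈ ball (0 : ℂ) (min ε (r₁ / 2)), z ∈ ball (0 : ℂ) ε := fun z hz =>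
    ball_subset_ball (min_le_left _ _) hz
  refine ⟨min ε (r₁ / 2), lt_min hε (by linarith), hlt, u, u 0, hu0,
    fun z hz => (hall z (hsub z hz)).1.2.2.1.continuousAt.continuousWithinAt,
    fun z hz => (hall z (hsub z hz)).1.1, fun z hz => (hall z (hsub z hz)).1.2.2.2.le,
    fun z hz => (hall z (hsub z hz)).2.1.le, fun z hz hz0 => ?_⟩
  obtain ⟨⟨h1, h2, -, -⟩, -, h5, h6⟩ := hall z (hsub z hz)
  have hne : f z - z ≠ 0 := by
    rw [h1]
    exact mul_ne_zero (pow_ne_zero _ hz0) h6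
  refine ⟨sub_ne_zero.1 hne, ?_⟩
  have h7 : z * (deriv f z - 1) / (f z - z) - (q + 1) = z * deriv u z / u z := by
    rw [h1, h2]
    field_simp
    ring
  rw [h7]
  exact h5.le

theorem tendstoUniformlyOn_deriv_closedBall {f : ℂ → ℂ} {fn : ℕ → ℂ → ℂ} {r₀ ρ : ℝ}
    (hlim : TendstoUniformlyOn fn f atTop (closedBall 0 r₀))
    (hfn : ∀ n, ∀ z ∈ ball (0 : ℂ) r₀, DifferentiableAt ℂ (fn n) z) (hρ : ρ < r₀) :
    TendstoUniformlyOn (fun n => deriv (fn n)) (deriv f) atTop (closedBall 0 ρ) := by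
  have h1 := (hlim.mono ball_subset_closedBall).tendstoLocallyUniformlyOn.deriv
    (Eventually.of_forall fun n z hz => (hfn n z hz).differentiableWithinAt) isOpen_ball
  exact (tendstoLocallyUniformlyOn_iff_forall_isCompact isOpen_ball).1 h1 _
    (closedBall_subset_ball hρ) (isCompact_closedBall _ _)

/-- The estimate of the logarithmic derivative of the displacement on an annulus persists under
small perturbations. -/
theorem eventually_log_deriv_displacement {f : ℂ → ℂ} {fn : ℕ → ℂ → ℂ} {q : ℕ} {ρ r : ℝ}
    (hr : 0 < r) (hrρ : 2 * r < ρ) (hfc : ContinuousOn f (closedBall 0 (2 * r)))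
    (hlim : TendstoUniformlyOn fn f atTop (closedBall 0 (2 * r)))
    (hlim' : TendstoUniformlyOn (fun n => deriv (fn n)) (deriv f) atTop (closedBall 0 (2 * r)))
    (hf : ∀ z ∈ ball (0 : ℂ) ρ, z ≠ 0 → f z ≠ z ∧
        ‖z * (deriv f z - 1) / (f z - z) - (q + 1)‖ ≤ 1 / 32) :
    ∀ᶠ n in atTop, ∀ y, r / 2 ≤ ‖y‖ → ‖y‖ ≤ 2 * r → fn n y ≠ y ∧
      ‖y * (deriv (fn n) y - 1) / (fn n y - y) - (q + 1)‖ ≤ 1 / 16 := by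
  set K : Set ℂ := closedBall 0 (2 * r) ∩ {y | r / 2 ≤ ‖y‖} with hK
  have hKc : IsCompact K := (isCompact_closedBall _ _).inter_right
    (isClosed_le continuous_const continuous_norm)
  have hKne : K.Nonempty := ⟨(r : ℂ), by
    simp only [hK, mem_inter_iff, mem_closedBall_zero_iff, mem_ofPred_eq, Complex.norm_real,
      Real.norm_eq_abs, abs_of_pos hr]
    constructor <;> linarith⟩
  have hvc : ContinuousOn (fun y => ‖f y - y‖) K :=
    ((hfc.mono inter_subset_left).sub continuousOn_id).norm
  obtain ⟨y₁, hy₁, hmin⟩ := hKc.exists_isMinOn hKne hvc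
  have hprop : ∀ y ∈ K, y ∈ ball (0 : ℂ) ρ ∧ y ≠ 0 := fun y hy =>
    ⟨closedBall_subset_ball hrρ hy.1, norm_pos_iff.1 ((half_pos hr).trans_le hy.2)⟩
  set m : ℝ := ‖f y₁ - y₁‖ with hm
  have hm0 : 0 < m := by
    obtain ⟨h1, h2⟩ := hprop y₁ hy₁
    exact norm_pos_iff.2 (sub_ne_zero.2 (hf _ h1 h2).1)
  -- The perturbation changes the numerator by at most `m / 64` and keeps `3/4` of the denominator:
  -- `(1/32 + 1/64) * (4/3) = 1/16`.
  set ε : ℝ := m / (64 * (2 * r + q + 1)) with hε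
  have hε0 : 0 < ε := by positivity
  have hεm : ε * (2 * r + q + 1) = m / 64 := by
    have : 2 * r + q + 1 ≠ 0 := by positivity
    rw [hε]; field_simp
  have hεm' : ε ≤ m / 64 := by
    rw [← hεm]
    have : (0 : ℝ) ≤ q := by positivity
    nlinarith
  filter_upwards [Metric.tendstoUniformlyOn_iff.1 hlim ε hε0,
    Metric.tendstoUniformlyOn_iff.1 hlim' ε hε0] with n hn hn' y hy1 hy2
  have hyb : y ∈ closedBall (0 : ℂ) (2 * r) := mem_closedBall_zero_iff.2 hy2
  have hyK : y ∈ K := ⟨hyb, hy1⟩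
  obtain ⟨hyρ, hy0⟩ := hprop y hyK
  obtain ⟨hne, hest⟩ := hf y hyρ hy0
  have h1 := hn y hyb
  have h2 := hn' y hyb
  rw [dist_comm, dist_eq_norm] at h1 h2
  have h3 : m ≤ ‖f y - y‖ := hmin hyK
  have hv0 : f y - y ≠ 0 := sub_ne_zero.2 hne
  have h4 : ‖f y - y‖ ≤ ‖fn n y - y‖ + ‖fn n y - f y‖ := by
    have := norm_sub_le (fn n y - y) (fn n y - f y)
    rwa [show fn n y - y - (fn n y - f y) = f y - y by ring] at this
  have h5 : 3 / 4 * ‖f y - y‖ ≤ ‖fn n y - y‖ := by linarith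
  have h6 : 0 < ‖fn n y - y‖ := by linarith
  have h7 : fn n y - y ≠ 0 := norm_pos_iff.1 h6
  refine ⟨sub_ne_zero.1 h7, ?_⟩
  have hest' : ‖y * (deriv f y - 1) - (q + 1) * (f y - y)‖ ≤ 1 / 32 * ‖f y - y‖ := by
    rw [div_sub' hv0, norm_div, div_le_iff₀ (norm_pos_iff.2 hv0)] at hest
    rwa [mul_comm (q + 1 : ℂ)]
  rw [div_sub' h7, norm_div, div_le_iff₀ h6]
  have h8 : y * (deriv (fn n) y - 1) - (fn n y - y) * (q + 1) =
      (y * (deriv f y - 1) - (q + 1) * (f y - y)) + (y * (deriv (fn n) y - deriv f y)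
        - (q + 1) * (fn n y - f y)) := by ring
  have h9 : ‖(q + 1 : ℂ)‖ = q + 1 := by
    rw [show (q + 1 : ℂ) = ((q + 1 : ℕ) : ℂ) by push_cast; ring, Complex.norm_natCast]
    push_cast; ring
  have h10 : ‖y * (deriv (fn n) y - deriv f y)‖ ≤ 2 * r * ε := by
    rw [norm_mul]; gcongr
  have h11 : ‖(q + 1 : ℂ) * (fn n y - f y)‖ ≤ (q + 1) * ε := by
    rw [norm_mul, h9]; gcongr
  rw [h8]
  refine (norm_add_le _ _).trans ?_
  have h12 := norm_sub_le (y * (deriv (fn n) y - deriv f y)) ((q + 1 : ℂ) * (fn n y - f y))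
  nlinarith

/-! ### Periods of the fixed points near the origin -/

theorem HolomorphicIterate.analyticAt {g : ℂ → ℂ} {q : ℕ} {r₀ : ℝ}
    (hg : HolomorphicIterate g q r₀) {z : ℂ} (hz : z ∈ closedBall (0 : ℂ) r₀) {d : ℕ}
    (hd : d ≤ q) : AnalyticAt ℂ g^[d] z := by
  induction d with
  | zero => exact analyticAt_id
  | succ d ih =>
    rw [Function.iterate_succ']
    exact (hg z hz d (by omega)).comp (ih (by omega))

/-- Orbits of `g` are kept in the half-size disk so that nearby orbits of `gn n` remain where the
convergence is uniform. -/
theorem tendstoUniformlyOn_iterate {g : ℂ → ℂ} {gn : ℕ → ℂ → ℂ} {r₀ : ℝ} {K : Set ℂ} {d : ℕ}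
    (hg : ContinuousOn g (closedBall 0 r₀)) (h : TendstoUniformlyOn gn g atTop (closedBall 0 r₀))
    (hr₀ : 0 < r₀) (hK : ∀ j < d, ∀ z ∈ K, g^[j] z ∈ ball (0 : ℂ) (r₀ / 2)) {j : ℕ} (hj : j ≤ d) :
    TendstoUniformlyOn (fun n => (gn n)^[j]) g^[j] atTop K := by
  induction j with
  | zero =>
    rw [Metric.tendstoUniformlyOn_iff]
    intro ε hε
    exact Eventually.of_forall fun n z _ => by simpa using hε
  | succ j ih =>
    have huc := (isCompact_closedBall (0 : ℂ) r₀).uniformContinuousOn_of_continuous hg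
    rw [Metric.uniformContinuousOn_iff] at huc
    rw [Metric.tendstoUniformlyOn_iff] at h ⊢
    intro ε hε
    obtain ⟨δ, hδ, hδ'⟩ := huc (ε / 2) (half_pos hε)
    filter_upwards [h (ε / 2) (half_pos hε), Metric.tendstoUniformlyOn_iff.1 (ih (by omega))
      (min δ (r₀ / 2)) (lt_min hδ (half_pos hr₀))] with n hn hn' z hz
    rw [Function.iterate_succ_apply', Function.iterate_succ_apply']
    have h1 := mem_ball.1 (hK j (by omega) z hz)
    have h2 := hn' z hz
    have h3 : (gn n)^[j] z ∈ closedBall (0 : ℂ) r₀ := by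
      rw [mem_closedBall]
      have := dist_triangle_left ((gn n)^[j] z) 0 (g^[j] z)
      have := h2.trans_le (min_le_right _ _)
      linarith
    have h4 := hδ' _ (mem_closedBall.2 (h1.le.trans (by linarith))) _ h3
      (h2.trans_le (min_le_left _ _))
    have h5 := hn _ h3
    have := dist_triangle (g (g^[j] z)) (g ((gn n)^[j] z)) (gn n ((gn n)^[j] z))
    linarith

/-- A fixed point of `g^[d]` whose multiplier is not `1` is locally unique, also for perturbations
of `g`. -/
theorem exists_radius_unique_fixed {g : ℂ → ℂ} {q : ℕ} {r₀ : ℝ} {lam : ℂ} (hr₀ : 0 < r₀)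
    (hg : HolomorphicIterate g q r₀) (hg0 : g 0 = 0) (hlam : deriv g 0 = lam) {d : ℕ} (hdq : d < q)
    (hd : lam ^ d ≠ 1) :
    ∃ ρ, 0 < ρ ∧ ∀ gn : ℕ → ℂ → ℂ, (∀ n, HolomorphicIterate (gn n) q r₀) → (∀ n, gn n 0 = 0) →
      TendstoUniformlyOn gn g atTop (closedBall 0 r₀) →
      ∀ᶠ n in atTop, ∀ z ∈ ball (0 : ℂ) ρ, (gn n)^[d] z = z → z = 0 := by
  have h0 : (0 : ℂ) ∈ closedBall (0 : ℂ) r₀ := mem_closedBall_self hr₀.le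
  have hfix : ∀ j, g^[j] 0 = 0 := fun j => Function.iterate_fixed hg0 j
  set κ : ℝ := ‖lam ^ d - 1‖ with hκ
  have hκ0 : 0 < κ := norm_pos_iff.2 (sub_ne_zero.2 hd)
  have hgd := hg.analyticAt h0 hdq.le
  have hga : AnalyticAt ℂ g 0 := hg 0 h0 0 (by omega)
  have hder : deriv g^[d] 0 = lam ^ d := by
    have := hga.differentiableAt.hasDerivAt
    rw [hlam] at this
    exact (HasDerivAt.iterate 0 this hg0 d).deriv
  have e1 : ∀ᶠ z in 𝓝 (0 : ℂ), ‖deriv g^[d] z - lam ^ d‖ < κ / 4 := by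
    have h1 : ContinuousAt (fun z => ‖deriv g^[d] z - lam ^ d‖) 0 :=
      (hgd.deriv.continuousAt.sub continuousAt_const).norm
    refine h1.eventually_lt_const ?_
    change ‖deriv g^[d] 0 - lam ^ d‖ < κ / 4
    rw [hder, sub_self, norm_zero]
    linarith
  have e2 : ∀ᶠ z in 𝓝 (0 : ℂ), ∀ j ∈ Finset.range d, ‖g^[j] z‖ < r₀ / 2 := by
    rw [Filter.eventually_all_finset]
    intro j hj
    have h1 : ContinuousAt (fun z => ‖g^[j] z‖) 0 :=
      (hg.analyticAt h0 (by have := Finset.mem_range.1 hj; omega)).continuousAt.norm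
    refine h1.eventually_lt_const ?_
    change ‖g^[j] 0‖ < r₀ / 2
    rw [hfix, norm_zero]
    linarith
  obtain ⟨ε, hε, hall⟩ := Metric.eventually_nhds_iff_ball.1 (e1.and e2)
  set ρ₁ : ℝ := min (ε / 2) r₀ with hρ₁
  have hρ₁0 : 0 < ρ₁ := lt_min (half_pos hε) hr₀
  have hρ₁ε : closedBall (0 : ℂ) ρ₁ ⊆ ball 0 ε :=
    closedBall_subset_ball ((min_le_left _ _).trans_lt (by linarith))
  have hρ₁r : closedBall (0 : ℂ) ρ₁ ⊆ closedBall 0 r₀ :=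
    closedBall_subset_closedBall (min_le_right _ _)
  refine ⟨ρ₁ / 2, half_pos hρ₁0, fun gn hgn hgn0 hlim => ?_⟩
  have hgc : ContinuousOn g (closedBall 0 r₀) := fun z hz =>
    (hg z hz 0 (by omega)).continuousAt.continuousWithinAt
  have hlim1 := tendstoUniformlyOn_iterate (K := closedBall 0 ρ₁) (d := d) hgc hlim hr₀
    (fun j hj z hz => mem_ball_zero_iff.2 ((hall z (hρ₁ε hz)).2 j (Finset.mem_range.2 hj))) le_rfl
  have hdiff : ∀ n, ∀ z ∈ ball (0 : ℂ) ρ₁, DifferentiableAt ℂ (gn n)^[d] z := fun n z hz =>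
    ((hgn n).analyticAt (hρ₁r (ball_subset_closedBall hz)) hdq.le).differentiableAt
  have hlim2 := tendstoUniformlyOn_deriv_closedBall hlim1 hdiff (by linarith : ρ₁ / 2 < ρ₁)
  filter_upwards [Metric.tendstoUniformlyOn_iff.1 hlim2 (κ / 4) (by positivity)] with n hn z hz hzf
  have hsub : ball (0 : ℂ) (ρ₁ / 2) ⊆ ball 0 ρ₁ := ball_subset_ball (by linarith)
  -- The iterate differs from multiplication by `lam ^ d` by a map with Lipschitz constant `κ / 2`.
  -- A fixed point thus satisfies `κ ‖z‖ ≤ κ / 2 * ‖z‖`.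
  have h1 := norm_sub_sub_le_of_deriv (F := (gn n)^[d]) (ρ := ρ₁ / 2) (η := κ / 2) (c := lam ^ d)
    (fun w hw => hdiff n w (hsub hw)) (fun w hw => by
      have h2 := hn w (ball_subset_closedBall hw)
      rw [dist_comm, dist_eq_norm] at h2
      have h3 := (hall w (hρ₁ε (ball_subset_closedBall (hsub hw)))).1
      have h4 := norm_add_le (deriv (gn n)^[d] w - deriv g^[d] w) (deriv g^[d] w - lam ^ d)
      rw [sub_add_sub_cancel] at h4
      linarith) hz (mem_ball_self (half_pos hρ₁0))
  rw [hzf, Function.iterate_fixed (hgn0 n) d, sub_zero,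
    show z - lam ^ d * z = -((lam ^ d - 1) * z) by ring, norm_neg, norm_mul, ← hκ] at h1
  by_contra hz0
  have := norm_pos_iff.2 hz0
  nlinarith

/-- The fixed points of `g^[q]` close to the origin, other than the origin, have exact period `q`,
also for perturbations of `g`. -/
theorem exists_radius_minimalPeriod {g : ℂ → ℂ} {q : ℕ} {r₀ : ℝ} {lam : ℂ} (hr₀ : 0 < r₀)
    (hq : 0 < q) (hg : HolomorphicIterate g q r₀) (hg0 : g 0 = 0) (hlam : deriv g 0 = lam)
    (hprim : IsPrimitiveRoot lam q) :
    ∃ ρ, 0 < ρ ∧ ∀ gn : ℕ → ℂ → ℂ, (∀ n, HolomorphicIterate (gn n) q r₀) → (∀ n, gn n 0 = 0) →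
      TendstoUniformlyOn gn g atTop (closedBall 0 r₀) →
      ∀ᶠ n in atTop, ∀ z ∈ ball (0 : ℂ) ρ, (gn n)^[q] z = z → z ≠ 0 →
        Function.minimalPeriod (gn n) z = q := by
  have hex : ∀ d : ℕ, ∃ ρ, 0 < ρ ∧ (d ∈ Finset.Ioo 0 q → ∀ gn : ℕ → ℂ → ℂ,
      (∀ n, HolomorphicIterate (gn n) q r₀) → (∀ n, gn n 0 = 0) →
      TendstoUniformlyOn gn g atTop (closedBall 0 r₀) →
      ∀ᶠ n in atTop, ∀ z ∈ ball (0 : ℂ) ρ, (gn n)^[d] z = z → z = 0) := by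
    intro d
    by_cases hd : d ∈ Finset.Ioo 0 q
    · obtain ⟨hd0, hdq⟩ := Finset.mem_Ioo.1 hd
      obtain ⟨ρ, hρ, h⟩ := exists_radius_unique_fixed hr₀ hg hg0 hlam hdq
        (hprim.pow_ne_one_of_pos_of_lt hd0.ne' hdq)
      exact ⟨ρ, hρ, fun _ => h⟩
    · exact ⟨1, one_pos, fun h => (hd h).elim⟩
  choose ρ hρ0 hρ using hex
  have hev : ∀ᶠ x in 𝓝[>] (0 : ℝ), ∀ d ∈ Finset.Ioo 0 q, x < ρ d := by
    rw [Filter.eventually_all_finset]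
    intro d _
    filter_upwards [Ioo_mem_nhdsGT (hρ0 d)] with x hx using hx.2
  obtain ⟨x, hx, hx0⟩ := (hev.and self_mem_nhdsWithin).exists
  refine ⟨x, hx0, fun gn hgn hgn0 hlim => ?_⟩
  have hall : ∀ᶠ n in atTop, ∀ d ∈ Finset.Ioo 0 q, ∀ z ∈ ball (0 : ℂ) (ρ d),
      (gn n)^[d] z = z → z = 0 := by
    rw [Filter.eventually_all_finset]
    exact fun d hd => hρ d hd gn hgn hgn0 hlim
  filter_upwards [hall] with n hn z hz hzq hz0
  have hper : Function.IsPeriodicPt (gn n) q z := hzq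
  have h1 := hper.minimalPeriod_pos hq
  have h2 := hper.minimalPeriod_le hq
  by_contra hne
  have hmem : Function.minimalPeriod (gn n) z ∈ Finset.Ioo 0 q :=
    Finset.mem_Ioo.2 ⟨h1, lt_of_le_of_ne h2 hne⟩
  exact hz0 (hn _ hmem z (ball_subset_ball (hx _ hmem).le hz)
    (Function.isPeriodicPt_minimalPeriod (gn n) z))

/-! ### Entering the disk, and the theorem -/

theorem norm_eq_of_mem_ball_iff {γ : ℝ → ℂ} {r s t : ℝ} (hγ : ContinuousOn γ (Iic 0)) (hst : s < t)
    (ht : t ≤ 0) (hiff : ∀ τ ≤ 0, γ τ ∈ ball (0 : ℂ) r ↔ s < τ ∧ τ < t) :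
    ‖γ s‖ = r ∧ ‖γ t‖ = r := by
  have hmaps : MapsTo γ (Ioo s t) (closedBall 0 r) := fun x hx =>
    ball_subset_closedBall ((hiff x (hx.2.le.trans ht)).2 hx)
  have hc : ContinuousOn γ (closure (Ioo s t)) := by
    rw [closure_Ioo hst.ne]
    exact hγ.mono fun x hx => hx.2.trans ht
  have hcl := hmaps.closure_of_continuousOn hc
  rw [isClosed_closedBall.closure_eq, closure_Ioo hst.ne] at hcl
  have h1 : γ s ∉ ball (0 : ℂ) r := fun h => ((hiff s (hst.le.trans ht)).1 h).1.ne rfl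
  have h2 : γ t ∉ ball (0 : ℂ) r := fun h => ((hiff t ht).1 h).2.ne rfl
  have h3 := hcl (left_mem_Icc.2 hst.le)
  have h4 := hcl (right_mem_Icc.2 hst.le)
  rw [mem_ball_zero_iff, not_lt] at h1 h2
  rw [mem_closedBall_zero_iff] at h3 h4
  exact ⟨le_antisymm h3 h1, le_antisymm h4 h2⟩

/-- An invariant arc stays close to a disk for one unit of time before it enters this disk. -/
theorem IsInvariantArc.norm_lt_of_entering {F : ℂ → ℂ} {r₀ r δ c s : ℝ} {γ : ℝ → ℂ}
    (hγ : IsInvariantArc F r₀ γ) (hs : s ≤ -1) (hrδ : r < δ) (hδ : δ ≤ r₀) (hrc : r < c)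
    (hF : ∀ x ∈ closedBall (0 : ℂ) r₀, δ ≤ ‖x‖ → c ≤ ‖F x‖)
    (hball : ∀ x ∈ Icc s (s + 1), ‖γ x‖ ≤ r) {x : ℝ} (hx : x ∈ Icc (s - 1) s) : ‖γ x‖ < δ := by
  by_contra! hcon
  have hsr : ‖γ s‖ ≤ r := hball s ⟨le_rfl, by linarith⟩
  have hc : ContinuousOn (fun τ => ‖γ τ‖) (Icc x s) :=
    (hγ.continuousOn.mono fun y hy => by
      have := hy.2
      simp only [mem_Iic]; linarith).norm
  -- Invariance is only known inside the disk of radius `r₀`, so a time `y` with `‖γ y‖ = δ` is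
  -- chosen. One step later the arc has modulus at least `c > r`, yet `y + 1` lies in `[s, s + 1]`.
  obtain ⟨y, hy, hyδ⟩ := intermediate_value_Icc' hx.2 hc ⟨(hsr.trans_lt hrδ).le, hcon⟩
  simp only at hyδ
  have hyb : γ y ∈ closedBall (0 : ℂ) r₀ := by
    rw [mem_closedBall_zero_iff, hyδ]
    exact hδ
  have h1 := hF _ hyb hyδ.ge
  rw [hγ.invariant y (hy.2.trans hs) hyb] at h1
  have h2 := hball (y + 1) ⟨by linarith [hx.1, hy.1], by linarith [hy.2]⟩
  linarith

theorem mainTheorem4 (g : ℂ → ℂ) (q : ℕ) (lam : ℂ) (r₀ : ℝ)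
    (hg : IsNondegenerateParabolic g q lam r₀) :
    ∃ R : ℝ, 0 < R ∧ R ≤ r₀ ∧ ∀ r : ℝ, 0 < r → r < R →
      ∀ gn : ℕ → ℂ → ℂ, IsPerturbation g q r₀ gn →
      ∀ γ : ℝ → ℂ, IsInvariantArc (g^[q]) r₀ γ → MapsTo γ (Iic 0) (ball 0 r₀) →
        Tendsto γ atBot (𝓝 0) →
      ∀ γn : ℕ → ℝ → ℂ, (∀ n, IsInvariantArc ((gn n)^[q]) r₀ (γn n)) →
        (∀ K : Set ℝ, IsCompact K → K ⊆ Iic 0 → TendstoUniformlyOn γn γ atTop K) →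
      ∀ s t : ℕ → ℝ, (∀ n, s n < t n ∧ t n ≤ 0) →
        (∀ n, ∀ τ ≤ 0, γn n τ ∈ ball (0 : ℂ) r ↔ s n < τ ∧ τ < t n) →
      ∀ᶠ n in atTop,
        (componentsOf (ball 0 r \ γn n '' Ioo (s n) (t n))).ncard = 2 ∧
        ∀ C ∈ componentsOf (ball 0 r \ γn n '' Ioo (s n) (t n)),
          (C ∩ ({0} ∪ bifurcatedCycle (gn n) q r₀)).Nonempty := by
  have hq : 1 ≤ q := hg.q_pos
  have hr₀ := hg.radius_pos
  have h0 : (0 : ℂ) ∈ closedBall (0 : ℂ) r₀ := mem_closedBall_self hr₀.le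
  set f : ℂ → ℂ := g^[q] with hf
  have hf0 : f 0 = 0 := Function.iterate_fixed hg.map_zero q
  have hfa : ∀ z ∈ closedBall (0 : ℂ) r₀, AnalyticAt ℂ f z := fun z hz =>
    hg.holomorphic.analyticAt hz le_rfl
  have hfc : ContinuousOn f (closedBall 0 r₀) := fun z hz =>
    (hfa z hz).continuousAt.continuousWithinAt
  -- Half of the bound required by `exists_inverse_displacement`; the other half absorbs the
  -- perturbation.
  have hη : (0 : ℝ) < 1 / (96 * (q + 2)) := by positivity
  obtain ⟨ρ, hρ, hρr₀, u, a, ha, hu, hfu, hua, hf', hfann⟩ :=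
    exists_local_data hq (hfa 0 h0) hg.nondegenerate hr₀ hη
  have hρb : ball (0 : ℂ) ρ ⊆ closedBall 0 r₀ :=
    ball_subset_closedBall.trans (closedBall_subset_closedBall hρr₀.le)
  have hflip : ∀ x ∈ ball (0 : ℂ) ρ, ∀ y ∈ ball (0 : ℂ) ρ,
      ‖(f x - f y) - (x - y)‖ ≤ 1 / 48 * ‖x - y‖ := by
    intro x hx y hy
    have h1 := norm_sub_sub_le_of_deriv (c := 1)
      (fun z hz => (hfa z (hρb hz)).differentiableAt) hf' hx hy
    rw [one_mul] at h1
    refine h1.trans ?_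
    gcongr
    have : (0 : ℝ) ≤ q := by positivity
    linarith
  -- By univalence `f` has no zero other than `0`, so it is bounded away from `0` off the disk of
  -- radius `ρ / 2`. The factor `2` leaves room for the perturbation.
  obtain ⟨c, hc0, hc⟩ : ∃ c : ℝ, 0 < c ∧
      ∀ x ∈ closedBall (0 : ℂ) r₀, ρ / 2 ≤ ‖x‖ → 2 * c ≤ ‖f x‖ := by
    have hK : IsCompact (closedBall (0 : ℂ) r₀ ∩ {x | ρ / 2 ≤ ‖x‖}) :=
      (isCompact_closedBall _ _).inter_right (isClosed_le continuous_const continuous_norm)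
    have hKne : (closedBall (0 : ℂ) r₀ ∩ {x | ρ / 2 ≤ ‖x‖}).Nonempty := by
      refine ⟨(ρ : ℂ), ?_, ?_⟩
      · rw [mem_closedBall_zero_iff, Complex.norm_real, Real.norm_eq_abs, abs_of_pos hρ]
        exact hρr₀.le
      · change ρ / 2 ≤ ‖(ρ : ℂ)‖
        rw [Complex.norm_real, Real.norm_eq_abs, abs_of_pos hρ]
        linarith
    obtain ⟨x₁, hx₁, hmin⟩ := hK.exists_isMinOn hKne (hfc.mono inter_subset_left).norm
    have hx₁0 : x₁ ≠ 0 := norm_pos_iff.1 ((half_pos hρ).trans_le hx₁.2)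
    have hfx₁ : f x₁ ≠ 0 := fun h =>
      hx₁0 (hg.univalent hx₁.1 h0 (h.trans hf0.symm))
    refine ⟨‖f x₁‖ / 2, half_pos (norm_pos_iff.2 hfx₁), fun x hx hx' => ?_⟩
    have : ‖f x₁‖ ≤ ‖f x‖ := hmin ⟨hx, hx'⟩
    linarith
  obtain ⟨ρ', hρ', hper⟩ := exists_radius_minimalPeriod hr₀ hg.q_pos hg.holomorphic hg.map_zero
    hg.multiplier hg.primitive
  -- `ρ / 4` leaves room for the inverse, `c` controls the arc just before entry, and `ρ'` ensures
  -- exact period `q`.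
  refine ⟨min (min (ρ / 4) c) (min ρ' r₀), by positivity,
    (min_le_right _ _).trans (min_le_right _ _), ?_⟩
  intro r hr hrR gn hgn γ hγ hγr₀ hγ0 γn hγn hlimγ s t hst hiff
  have hrρ : r < ρ / 4 := hrR.trans_le ((min_le_left _ _).trans (min_le_left _ _))
  have hrc : r < c := hrR.trans_le ((min_le_left _ _).trans (min_le_right _ _))
  have hrρ' : r < ρ' := hrR.trans_le ((min_le_right _ _).trans (min_le_left _ _))
  -- the perturbed maps
  have hfna : ∀ n, ∀ z ∈ closedBall (0 : ℂ) r₀, DifferentiableAt ℂ (gn n)^[q] z := fun n z hz =>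
    ((hgn.holomorphic n).analyticAt hz le_rfl).differentiableAt
  have hlim := hgn.tendsto_iterate
  have hlim' : TendstoUniformlyOn (fun n => deriv (gn n)^[q]) (deriv f) atTop (closedBall 0 ρ) :=
    tendstoUniformlyOn_deriv_closedBall hlim
      (fun n z hz => hfna n z (ball_subset_closedBall hz)) hρr₀
  have ev₁ : ∀ᶠ n in atTop, ∀ z ∈ ball (0 : ℂ) ρ,
      ‖deriv (gn n)^[q] z - 1‖ ≤ 1 / (48 * (q + 2)) := by
    filter_upwards [Metric.tendstoUniformlyOn_iff.1 hlim' _ hη] with n hn z hz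
    have h1 := hn z (ball_subset_closedBall hz)
    rw [dist_comm, dist_eq_norm] at h1
    have h2 := norm_add_le (deriv (gn n)^[q] z - deriv f z) (deriv f z - 1)
    rw [sub_add_sub_cancel] at h2
    have h3 : (1 : ℝ) / (48 * (q + 2)) = 1 / (96 * (q + 2)) + 1 / (96 * (q + 2)) := by
      field_simp; norm_num
    linarith [hf' z hz]
  have h2r : closedBall (0 : ℂ) (2 * r) ⊆ closedBall 0 r₀ :=
    closedBall_subset_closedBall (by linarith)
  have ev₂ := eventually_log_deriv_displacement hr (by linarith : 2 * r < ρ) (hfc.mono h2r)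
    (hlim.mono h2r) (hlim'.mono (closedBall_subset_closedBall (by linarith))) hfann
  have ev₃ : ∀ᶠ n in atTop, ∀ x ∈ closedBall (0 : ℂ) r₀, ρ / 2 ≤ ‖x‖ → c ≤ ‖(gn n)^[q] x‖ := by
    filter_upwards [Metric.tendstoUniformlyOn_iff.1 hlim c hc0] with n hn x hx hx'
    have h1 := hn x hx
    rw [dist_eq_norm] at h1
    have h2 := norm_sub_norm_le (f x) ((gn n)^[q] x)
    linarith [hc x hx hx']
  have ev₄ := hper gn hgn.holomorphic hgn.map_zero hgn.tendsto
  -- the limit arc near the origin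
  obtain ⟨T, hT1, hT⟩ : ∃ T : ℝ, T ≤ -1 ∧ ∀ τ ≤ T, ‖γ τ‖ < r := by
    have h1 : ∀ᶠ τ in atBot, ‖γ τ‖ < r := by
      have := hγ0.norm
      rw [norm_zero] at this
      exact this.eventually (gt_mem_nhds hr)
    obtain ⟨B, hB⟩ := eventually_atBot.1 h1
    exact ⟨min B (-1), min_le_right _ _, fun τ hτ => hB τ (hτ.trans (min_le_left _ _))⟩
  have hTsub : Iic T ⊆ Iic (0 : ℝ) := Iic_subset_Iic.2 (by linarith)
  obtain ⟨L, hL, hLexp, hLturn⟩ := exists_log_displacement_of_tendsto_zero hq hρ hflip hf0 hfu hu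
    ha hua (hγ.continuousOn.mono hTsub) (hγ.injOn.mono hTsub)
    (fun τ hτ => mem_ball_zero_iff.2 ((hT τ hτ).trans (by linarith)))
    (fun τ hτ => hγ.invariant τ (by linarith)
      (ball_subset_closedBall (hγr₀ (by simp only [mem_Iic]; linarith)))) hγ0
    (t₀ := T - 2) (by linarith)
  have hx₀ : T - 1 + 1 = T := by ring
  -- `L` is indexed by the initial time of the chord, whereas the displacement `φ` is taken at its
  -- final point; hence the shift by `1`.
  have ev₅ := eventually_exists_log_of_tendstoUniformlyOn (x₀ := T - 1) (L := fun x => L (x - 1))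
    (F := fun x => γ x - γ (x - 1)) (Fn := fun n x => γn n x - γn n (x - 1)) (by fun_prop)
    (fun x hx => by
      rw [hLexp (x - 1) ⟨by linarith [hx.1], by linarith [hx.2]⟩, sub_add_cancel])
    (by
      have e1 : T - 1 + 1 - 1 = T - 2 + 1 := by ring
      have e2 : T - 1 - 1 = T - 2 := by ring
      rw [e1, e2]
      exact hLturn)
    (Eventually.of_forall fun n => by
      have hc1 := (hγn n).continuousOn
      refine (hc1.mono ?_).sub (hc1.comp (by fun_prop) ?_)
      · intro x hx
        have := hx.2
        simp only [mem_Iic]; linarith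
      · intro x hx
        have := hx.2
        simp only [mem_Iic]; linarith)
    (by
      have hK := hlimγ (Icc (T - 2) T) isCompact_Icc fun x hx => by
        have := hx.2
        simp only [mem_Iic]; linarith
      rw [Metric.tendstoUniformlyOn_iff] at hK ⊢
      intro ε hε
      filter_upwards [hK (ε / 2) (half_pos hε)] with n hn x hx
      have h1 := hn x ⟨by linarith [hx.1], by linarith [hx.2]⟩
      have h2 := hn (x - 1) ⟨by linarith [hx.1], by linarith [hx.2]⟩
      have h3 := dist_sub_sub_le (γ x) (γ (x - 1)) (γn n x) (γn n (x - 1))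
      linarith)
  have ev₆ : ∀ τ ≤ T, ∀ᶠ n in atTop, γn n τ ∈ ball (0 : ℂ) r := by
    intro τ hτ
    have h1 := (hlimγ {τ} isCompact_singleton (by
      simp only [singleton_subset_iff, mem_Iic]; linarith)).tendsto_at rfl
    exact h1.eventually (isOpen_ball.mem_nhds (mem_ball_zero_iff.2 (hT τ hτ)))
  filter_upwards [ev₁, ev₂, ev₃, ev₄, ev₅, ev₆ T le_rfl, ev₆ (T - 2) (by linarith)]
    with n hn₁ hn₂ hn₃ hn₄ hn₅ hn₆ hn₇
  obtain ⟨L₀, hL₀, hL₀', hturn⟩ := hn₅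
  obtain ⟨hstn, htn⟩ := hst n
  have harc := hγn n
  -- Since `T - 2` and `T` are both times inside the disk, the crossing lasts longer than `2` and
  -- contains the reference interval `[T - 1, T]`.
  have hTt := ((hiff n T (by linarith)).1 hn₆).2
  have hsT := ((hiff n (T - 2) (by linarith)).1 hn₇).1
  obtain ⟨hs, ht⟩ := norm_eq_of_mem_ball_iff harc.continuousOn hstn htn (hiff n)
  have hsub : Icc (s n) (t n) ⊆ Iic 0 := fun x hx => hx.2.trans htn
  have hin : ∀ x ∈ Ioo (s n) (t n), ‖γn n x‖ < r := fun x hx =>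
    mem_ball_zero_iff.1 ((hiff n x (hx.2.le.trans htn)).2 hx)
  have hball : ∀ x ∈ Ico (s n) (t n), ‖γn n x‖ ≤ r := by
    intro x hx
    rcases hx.1.eq_or_lt with h | h
    · rw [← h]
      exact hs.le
    · exact (hin x ⟨h, hx.2⟩).le
  have hfn0 : (gn n)^[q] 0 = 0 := Function.iterate_fixed (hgn.map_zero n) q
  obtain ⟨φ, φ', hφ₁, hφ₂, hφ₃, hφ₄, hφ₅, hφ₆, hφ₇⟩ := exists_inverse_displacement (q := q) hr
    (by linarith : 4 * r ≤ ρ) (fun z hz => hfna n z (hρb hz)) hfn0 hn₁ hn₂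
  -- One step before entry the arc is still where `F` is inverted, so the preimage of the entry
  -- point really is `γn n (s n - 1)`.
  have hent : ‖γn n (s n - 1)‖ < ρ / 2 :=
    harc.norm_lt_of_entering (by linarith) (by linarith) (by linarith) hrc hn₃
      (fun x hx => hball x ⟨hx.1, by linarith [hx.2]⟩) ⟨le_rfl, by linarith⟩
  have horb : ∀ y ≤ -1, ‖γn n y‖ < ρ → ‖γn n (y + 1)‖ ≤ r →
      φ (γn n (y + 1)) = γn n (y + 1) - γn n y := by
    intro y hy hyρ hy1
    have hyb := mem_ball_zero_iff.2 hyρ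
    have h1 := harc.invariant y hy (hρb hyb)
    have h2 := hφ₆ _ hyb
    rw [h1] at h2
    exact h2 (mem_closedBall_zero_iff.2 hy1)
  have hφs := horb (s n - 1) (by linarith) (by linarith) (by rw [sub_add_cancel]; exact hs.le)
  rw [sub_add_cancel] at hφs
  have hsep := orbit_arc_separates hr hq hφ₁ hφ₂ hφ₃ hφ₄ hφ₅ (by linarith : s n + 2 ≤ t n)
    (harc.continuousOn.mono hsub) (harc.injOn.mono hsub) hs ht hin
    (fun x hx => by
      have h1 := horb (x - 1) (by linarith [hx.2])
        ((hball _ ⟨by linarith [hx.1], by linarith [hx.2]⟩).trans_lt (by linarith))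
      rw [sub_add_cancel] at h1
      refine h1 ?_
      rcases hx.2.eq_or_lt with h | h
      · rw [h]
        exact ht.le
      · exact hball x ⟨by linarith [hx.1], h⟩)
    (by
      -- The time `s n - 1` precedes the crossing, so this preimage is not in the open disk.
      rw [hφs, sub_sub_cancel]
      by_contra! h
      have := ((hiff n (s n - 1) (by linarith)).1 (mem_ball_zero_iff.2 h)).1
      linarith)
    (x₀ := T - 1) ⟨by linarith, by linarith⟩ hL₀
    (fun x hx => by
      have hxT : x ≤ T := by linarith [hx.2]
      have h1 := horb (x - 1) (by linarith)
        ((hball _ ⟨by linarith [hx.1], by linarith⟩).trans_lt (by linarith))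
      rw [sub_add_cancel] at h1
      rw [hL₀' x hx, h1 (hball x ⟨by linarith [hx.1], by linarith⟩)])
    hturn
  refine ⟨hsep.1, fun C hC => ?_⟩
  obtain ⟨z, hzC, hz⟩ := hsep.2 C hC
  have hzb : z ∈ ball (0 : ℂ) r := by
    obtain ⟨w, -, rfl⟩ := hC
    exact (connectedComponentIn_subset _ _ hzC).1
  have hzfix := hφ₇ z (ball_subset_closedBall hzb) hz
  refine ⟨z, hzC, ?_⟩
  by_cases hz0 : z = 0
  · exact Or.inl hz0
  · exact Or.inr ⟨ball_subset_closedBall (ball_subset_ball (by linarith) hzb), hz0,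
      hn₄ z (ball_subset_ball hrρ'.le hzb) hzfix hz0⟩
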